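/- **Theorem (convergence of online PCA from a deterministic initial point).** There exist absolute constants $b_1\in(0,\ln^2 2/16)$ and $C_0,C_1,C_2>0$ such that the following holds. Let $d\ge 2$, let $\Sigma\in\mathbb R^{d\times d}$ be symmetric positive semidefinite with eigenvalues $\lambda_1>\lambda_2\ge\cdots\ge\lambda_d\ge 0$ (counted with multiplicity), and let $\mathbf u^*$ be its principal component, i.e. a unit vector maximizing $\mathbf w^\top\Sigma\mathbf w$ over the unit sphere (unique up to sign). Let $Z$ be a random vector in $\mathbb R^d$ with $\mathbb E[Z]=0$, $\mathbb E[ZZ^\top]=\mathbf I_d$ and $\|\mathbf v^\top Z\|_{\psi_2}\le 1$ for every unit vector $\mathbf v$, where $\|Y\|_{\psi_2}=\sup_{p\ge1}p^{-1/2}(\mathbb E|Y|^p)^{1/p}$. Let $X^{(1)},X^{(2)},\dots$ be independent and identically distributed with the law of $\Sigma^{1/2}Z$, where $\Sigma^{1/2}$ is the symmetric positive semidefinite square root of $\Sigma$. For a deterministic unit vector $\mathbf u^{(0)}$ and a stepsize $\beta>0$ let $$\mathbf u^{(n)}=\Pi\{\mathbf u^{(n-1)}+\beta X^{(n)}(X^{(n)})^\top\mathbf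 u^{(n-1)}\},\qquad \Pi\mathbf w=\mathbf w/\|\mathbf w\|,\qquad n\ge1 .$$ Put $\widehat\beta=\lambda_1^2(\lambda_1-\lambda_2)^{-1}\beta$ and, for $s>0$ and $c>0$, $$N^*_{\beta,s}=\left\lceil\frac{s\log\big(\lambda_1^{-2}(\lambda_1-\lambda_2)\beta^{-1}\big)}{-\log(1-\beta(\lambda_1-\lambda_2))}\right\rceil,\qquad N^o_\beta(c)=\left\lceil\frac{\log(4cd)}{-\log(1-\beta(\lambda_1-\lambda_2))}\right\rceil .$$ Let $c^*>1$ satisfy $\tan^2\angle(\mathbf u^{(0)},\mathbf u^*)\le c^*d$ (with $\tan^2(\pi/2)=\infty$). Then for all $\varepsilon\in(0,1/8)$, all $\beta>0$ with $$d\,\widehat\beta^{\,1-2\varepsilon}\le b_1/c^*,$$ and all $t>1$, there is an event $\mathcal H_*$ with $$\mathbb P(\mathcal H_*)\ge 1-2(d+2)N^o_\beta(c^*)\exp\big(-C_0\widehat\beta^{-2\varepsilon}\big)-4dN^*_{\beta,t}\exp\big(-C_1\widehat\beta^{-2\varepsilon}\big)$$ such that, for every integer $n\in[N^*_{\beta,1}+N^o_\beta(c^*),\,N^*_{\beta,t}]$,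 $$\mathbb E\big[\tan^2\angle(\mathbf u^{(n)},\mathbf u^*)\,\mathbf 1_{\mathcal H_*}\big]\le\big(1-\beta(\lambda_1-\lambda_2)\big)^{2(n-N^o_\beta(c^*))}+C_2\sum_{k=2}^d\frac{\lambda_1\lambda_k+\lambda_1^2\,\widehat\beta^{\,0.5-4\varepsilon}}{\lambda_1-\lambda_k}\cdot\beta .$$ -/

import Mathlib

open MeasureTheory ProbabilityTheory
open scoped ENNReal MatrixOrder

noncomputable section

/-- The linear action of a real `d × d` matrix on `ℝ^d` with its Euclidean norm. -/
def matAct {d : ℕ} (S : Matrix (Fin d) (Fin d) ℝ) (x : EuclideanSpace ℝ (Fin d)) :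
    EuclideanSpace ℝ (Fin d) :=
  WithLp.toLp 2 (S.mulVec x.ofLp)

/-- The eigenvalues of a real symmetric matrix in decreasing order, with multiplicity.
The index is shifted by one: `eigval hS 0` is the largest eigenvalue `λ₁`. -/
def eigval {d : ℕ} {S : Matrix (Fin d) (Fin d) ℝ} (hS : S.IsHermitian) (k : Fin d) : ℝ :=
  hS.eigenvalues₀ (Fin.cast (Fintype.card_fin d).symm k)

/-- `u` is a principal component of `S`: a unit vector that maximizes `wᵀ S w` over the
unit sphere. -/
def IsPrincipalComponent {d : ℕ} (S : Matrix (Fin d) (Fin d) ℝ)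
    (u : EuclideanSpace ℝ (Fin d)) : Prop :=
  ‖u‖ = 1 ∧
    IsMaxOn (fun w : EuclideanSpace ℝ (Fin d) => inner ℝ w (matAct S w)) (Metric.sphere 0 1) u

/-- The subgaussian norm `sup_{p ≥ 1} p^{-1/2} (E |Y|^p)^{1/p}`, with values in `[0, ∞]`. -/
def psi2Norm {Ω : Type*} [MeasurableSpace Ω] (Y : Ω → ℝ) (P : Measure Ω) : ℝ≥0∞ :=
  ⨆ (p : ℝ) (_ : 1 ≤ p), ENNReal.ofReal (p ^ (-(1 / 2) : ℝ)) * eLpNorm Y (ENNReal.ofReal p) P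

/-- The random vector `Z` has mean zero, identity covariance, and every one-dimensional
projection on a unit vector has subgaussian norm at most one. -/
structure IsIsotropicSubgaussian {d : ℕ} {Ω : Type*} [MeasurableSpace Ω]
    (Z : Ω → EuclideanSpace ℝ (Fin d)) (P : Measure Ω) : Prop where
  measurable : Measurable Z
  mean : ∫ ω, Z ω ∂P = 0
  cov : ∀ i j, ∫ ω, Z ω i * Z ω j ∂P = (1 : Matrix (Fin d) (Fin d) ℝ) i j
  subgaussian : ∀ v : EuclideanSpace ℝ (Fin d), ‖v‖ = 1 →
    psi2Norm (fun ω => inner ℝ v (Z ω)) P ≤ 1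

/-- The radial projection onto the unit sphere. It is applied below only to nonzero vectors. -/
def sphereProj {d : ℕ} (w : EuclideanSpace ℝ (Fin d)) : EuclideanSpace ℝ (Fin d) :=
  ‖w‖⁻¹ • w

/-- The online PCA (Oja) iterates with constant stepsize `β`, started at `u0`. The sample drawn
at step `n + 1` is `X n`, and `(X n)(X n)ᵀ u` is `⟨X n, u⟩ X n`. -/
def onlinePCA {d : ℕ} {Ω : Type*} (β : ℝ) (u0 : EuclideanSpace ℝ (Fin d))
    (X : ℕ → Ω → EuclideanSpace ℝ (Fin d)) : ℕ → Ω → EuclideanSpace ℝ (Fin d)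
  | 0 => fun _ => u0
  | n + 1 => fun ω =>
      sphereProj (onlinePCA β u0 X n ω
        + β • (inner ℝ (X n ω) (onlinePCA β u0 X n ω) • X n ω))

open Classical in
/-- `tan² ∠(u, w)`, equal to `∞` when the vectors are orthogonal. -/
def tanSqAngle {d : ℕ} (u w : EuclideanSpace ℝ (Fin d)) : ℝ≥0∞ :=
  if InnerProductGeometry.angle u w = Real.pi / 2 then ∞
  else ENNReal.ofReal (Real.tan (InnerProductGeometry.angle u w) ^ 2)

/-- The rescaled stepsize `λ₁² (λ₁ - λ₂)⁻¹ β`. -/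
def betaHat (l1 l2 β : ℝ) : ℝ := l1 ^ 2 * (l1 - l2)⁻¹ * β

/-- The rescaled time `N*_{β,s}`. -/
def rescaledTime (l1 l2 β s : ℝ) : ℕ :=
  ⌈s * Real.log ((l1 ^ 2)⁻¹ * (l1 - l2) * β⁻¹) / (-Real.log (1 - β * (l1 - l2)))⌉₊

/-- The rescaled time `N°_β(c)` in dimension `d`. -/
def burnInTime (d : ℕ) (l1 l2 β c : ℝ) : ℕ :=
  ⌈Real.log (4 * c * d) / (-Real.log (1 - β * (l1 - l2)))⌉₊

end

/-! Let `e` be an eigenbasis with top vector `e o`, and rescale each iterate to `w = u / ⟨e o, u⟩`.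
The normalisation `Π` is then irrelevant, `tan²` of the angle is `‖w‖² - 1`, the sum of the squared
coordinates `k ≠ o`, and `w` is a Markov chain with step `ratioStep`. A step is called good if
`‖w‖²` is at most `Rmax = 8 c d` and the sample perturbs `w` little. On good steps the division by
`1 + β⟨e o, x⟩⟨w, x⟩` can be expanded to second order. The first-order terms have exact means given
by the covariance, and the second-order terms are controlled by subgaussian moments.

Two consequences carry the proof. The first is that the chain stays good. Up to the first bad step,
the `m`-th moment of `‖w‖²` grows at most additively, by `2 * 2 ^ m` per step
(`lintegral_norm_pow_le`): the spectral gap pushes the norm down once `‖w‖² ≥ 2`. Markov's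
inequality at level `Rmax`, together with tail bounds for the samples, gives failure probability at
most `N (4 + 2N) e^{-m}` over `N` steps (`measure_compl_goodEvent_le`). The choice `m = ⌊β̂^(-2ε)⌋`
makes this the required exponential, and `failure_bound` absorbs the factor quadratic in `N`.

The second is that on the good event the mean square of coordinate `k` contracts by `1 - 7/4 β(λ₁ -
λ_k)` per step, up to noise `208 β² λ_k λ₁ ‖w‖²`. The noise couples the coordinates. The coupled
recursions are solved simultaneously by a geometric term of ratio `1 - 3/2 β(λ₁ - λ₂)` plus the
stationary level `240 β λ_k λ₁ / (λ₁ - λ_k)` (`setLIntegral_coord_sq_le`).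

After the two prescribed times the summed geometric term is at most `β̂^{3/2}`. This fits into the
`β̂^{0.5-4ε}` correction of the second eigenvalue's summand alone. The leading term of the stated
bound is therefore needed only to be nonnegative, and the burn-in part of the allowed failure
probability likewise. -/

set_option linter.unusedSectionVars false

/-! ### Moments of projections of a sample. -/

/-- The covariance and the even moments of the one-dimensional projections of `μ`, in terms of
an eigenbasis `e` of the covariance with eigenvalues `lam`. -/
structure SpectralMoments {ι E : Type*} [Fintype ι] [NormedAddCommGroup E] [InnerProductSpace ℝ E]
    [MeasurableSpace E] (e : OrthonormalBasis ι ℝ E) (lam : ι → ℝ) (μ : Measure E) : Prop where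
  lam_nonneg : ∀ k, 0 ≤ lam k
  cov : ∀ v w, ∫ x, inner ℝ v x * inner ℝ w x ∂μ
    = ∑ k, lam k * (inner ℝ (e k) v * inner ℝ (e k) w)
  integrable_pow : ∀ v (j : ℕ), Integrable (fun x => inner ℝ v x ^ (2 * j)) μ
  moment_le : ∀ v (j : ℕ), 1 ≤ j → ∫ x, inner ℝ v x ^ (2 * j) ∂μ
    ≤ (2 * j) ^ j * (∑ k, lam k * inner ℝ (e k) v ^ 2) ^ j

namespace SpectralMoments

variable {ι E : Type*} [Fintype ι] [NormedAddCommGroup E] [InnerProductSpace ℝ E]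
    [MeasurableSpace E] [BorelSpace E] {e : OrthonormalBasis ι ℝ E} {lam : ι → ℝ} {μ : Measure E}

theorem quad_nonneg (h : SpectralMoments e lam μ) (v : E) :
    0 ≤ ∑ k, lam k * inner ℝ (e k) v ^ 2 :=
  Finset.sum_nonneg fun k _ => mul_nonneg (h.lam_nonneg k) (sq_nonneg _)

theorem quad_basis (e : OrthonormalBasis ι ℝ E) (lam : ι → ℝ) (k : ι) :
    ∑ j, lam j * inner ℝ (e j) (e k) ^ 2 = lam k := by
  classical
  rw [Finset.sum_eq_single k]
  · simp
  · intro b _ hb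
    rw [e.inner_eq_ite, if_neg hb]; simp
  · simp

theorem quad_le {l1 : ℝ} (hl : ∀ k, lam k ≤ l1) (e : OrthonormalBasis ι ℝ E) (v : E) :
    ∑ k, lam k * inner ℝ (e k) v ^ 2 ≤ l1 * ‖v‖ ^ 2 := by
  have : ‖v‖ ^ 2 = ∑ k, inner ℝ (e k) v ^ 2 := by
    rw [← e.sum_sq_norm_inner_right v]; simp
  rw [this, Finset.mul_sum]
  exact Finset.sum_le_sum fun k _ => mul_le_mul_of_nonneg_right (hl k) (sq_nonneg _)

theorem integrable_mul_pow (h : SpectralMoments e lam μ) (v w : E) (j : ℕ) :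
    Integrable (fun x => inner ℝ v x ^ (2 * j) * inner ℝ w x ^ (2 * j)) μ := by
  refine ((h.integrable_pow v (2 * j)).add (h.integrable_pow w (2 * j))).mono'
    (by fun_prop) (Filter.Eventually.of_forall fun x => ?_)
  have h1 : inner ℝ v x ^ (2 * (2 * j)) = (inner ℝ v x ^ (2 * j)) ^ 2 := by ring
  have h2 : inner ℝ w x ^ (2 * (2 * j)) = (inner ℝ w x ^ (2 * j)) ^ 2 := by ring
  simp only [Pi.add_apply, h1, h2]
  rw [Real.norm_eq_abs, abs_le]
  constructor <;> nlinarith [sq_nonneg (inner ℝ v x ^ (2 * j) + inner ℝ w x ^ (2 * j)),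
    sq_nonneg (inner ℝ v x ^ (2 * j) - inner ℝ w x ^ (2 * j)),
    sq_nonneg (inner ℝ v x ^ (2 * j)), sq_nonneg (inner ℝ w x ^ (2 * j))]

theorem integrable_mul (h : SpectralMoments e lam μ) (v w : E) :
    Integrable (fun x => inner ℝ v x * inner ℝ w x) μ := by
  refine ((h.integrable_pow v 1).add (h.integrable_pow w 1)).mono'
    (by fun_prop) (Filter.Eventually.of_forall fun x => ?_)
  simp only [Pi.add_apply, mul_one]
  rw [Real.norm_eq_abs, abs_le]
  constructor <;> nlinarith [sq_nonneg (inner ℝ v x + inner ℝ w x),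
    sq_nonneg (inner ℝ v x - inner ℝ w x), sq_nonneg (inner ℝ v x), sq_nonneg (inner ℝ w x)]

/-- Cauchy–Schwarz, with the moment of order `4j` applied to each factor. -/
theorem mul_moment_le (h : SpectralMoments e lam μ) (v w : E) {j : ℕ} (hj : 1 ≤ j) :
    ∫ x, inner ℝ v x ^ (2 * j) * inner ℝ w x ^ (2 * j) ∂μ ≤
      (4 * j) ^ (2 * j) * ((∑ k, lam k * inner ℝ (e k) v ^ 2) ^ j
        * (∑ k, lam k * inner ℝ (e k) w ^ 2) ^ j) := by
  have key : ∀ v : E, (∫ x, (inner ℝ v x ^ (2 * j)) ^ (2 : ℝ) ∂μ) ^ (1 / (2 : ℝ)) ≤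
      (4 * j) ^ j * (∑ k, lam k * inner ℝ (e k) v ^ 2) ^ j := by
    intro v
    have h0 := h.quad_nonneg v
    have h1 := h.moment_le v (2 * j) (by omega)
    rw [← Real.sqrt_eq_rpow]
    refine Real.sqrt_le_iff.2 ⟨by positivity, ?_⟩
    refine le_trans (le_of_eq ?_) (h1.trans (le_of_eq ?_))
    · congr 1; ext x
      rw [Real.rpow_two]; ring
    · push_cast; ring
  have hmem : ∀ v : E, MemLp (fun x => inner ℝ v x ^ (2 * j)) (ENNReal.ofReal 2) μ := by
    intro v
    rw [show ENNReal.ofReal 2 = 2 by simp, memLp_two_iff_integrable_sq (by fun_prop)]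
    exact (h.integrable_pow v (2 * j)).congr (Filter.Eventually.of_forall fun x => by
      simp only; ring)
  have := integral_mul_le_Lp_mul_Lq_of_nonneg (μ := μ) Real.HolderConjugate.two_two
    (f := fun x => inner ℝ v x ^ (2 * j)) (g := fun x => inner ℝ w x ^ (2 * j))
    (Filter.Eventually.of_forall fun x => by simp only [Pi.zero_apply]; rw [pow_mul]; positivity)
    (Filter.Eventually.of_forall fun x => by simp only [Pi.zero_apply]; rw [pow_mul]; positivity)
    (hmem v) (hmem w)
  refine this.trans ?_
  have h0 := h.quad_nonneg v
  refine (mul_le_mul (key v) (key w)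
    (Real.rpow_nonneg (integral_nonneg fun x => Real.rpow_nonneg (by rw [pow_mul]; positivity) _) _)
    (by positivity)).trans (le_of_eq ?_)
  ring

end SpectralMoments

/-! ### The rescaled step and the contraction of its coordinates. -/

/-- One step of the online PCA iteration for the vector rescaled to have inner product one
with `e0`. -/
noncomputable def ratioStep {E : Type*} [NormedAddCommGroup E] [InnerProductSpace ℝ E]
    (e0 : E) (β : ℝ) (w x : E) : E :=
  (1 + β * (inner ℝ e0 x * inner ℝ w x))⁻¹ • (w + (β * inner ℝ w x) • x)

/-- The pairs of a rescaled iterate of squared norm at most `Rmax` and a sample of moderate size,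
for which the step is a small relative perturbation. -/
def goodStep {E : Type*} [NormedAddCommGroup E] [InnerProductSpace ℝ E]
    (e0 : E) (β : ℝ) (m : ℕ) (Rmax : ℝ) : Set (E × E) :=
  {p | inner ℝ e0 p.1 = 1 ∧ ‖p.1‖ ^ 2 ≤ Rmax ∧
    8 * m * |β * (inner ℝ e0 p.2 * inner ℝ p.1 p.2)| ≤ 1 ∧
    8 * m * (β * inner ℝ p.1 p.2 ^ 2) ≤ ‖p.1‖ ^ 2 ∧
    4 * m * (β ^ 2 * (inner ℝ p.1 p.2 ^ 2 * ‖p.2‖ ^ 2)) ≤ ‖p.1‖ ^ 2}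

theorem inv_one_add_sq_le {a : ℝ} (ha : |a| ≤ 1 / 8) : ((1 + a)⁻¹) ^ 2 ≤ 1 - 2 * a + 4 * a ^ 2 := by
  obtain ⟨h1, h2⟩ := abs_le.1 ha
  rw [inv_pow, inv_le_iff_one_le_mul₀ (by nlinarith)]
  have : (1 - 2 * a + 4 * a ^ 2) * (1 + a) ^ 2 = 1 + a ^ 2 * (1 + 6 * a + 4 * a ^ 2) := by ring
  rw [this]
  nlinarith [mul_nonneg (sq_nonneg a) (show (0 : ℝ) ≤ 1 + 6 * a + 4 * a ^ 2 by nlinarith)]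

/-- The terms linear in `a` and `b` are kept exact, since their means produce the drift; only the
quadratic terms get generous constants. -/
theorem sq_add_div_le {U a b : ℝ} (ha : |a| ≤ 1 / 8) :
    ((1 + a)⁻¹ * (U + b)) ^ 2 ≤ U ^ 2 + 2 * U * b - 2 * U ^ 2 * a + 13 * b ^ 2
      + 10 * U ^ 2 * a ^ 2 := by
  obtain ⟨h1, h2⟩ := abs_le.1 ha
  have h3 := inv_one_add_sq_le ha
  rw [mul_pow]
  refine (mul_le_mul_of_nonneg_right h3 (sq_nonneg _)).trans ?_
  have ha2 : a ^ 2 ≤ 1 / 64 := by nlinarith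
  have k1 : 0 ≤ (b + a * U) ^ 2 := sq_nonneg _
  have k2 : 0 ≤ (1 / 4 + 2 * a) * b ^ 2 := mul_nonneg (by linarith) (sq_nonneg _)
  have k3 : 0 ≤ (1 / 64 - a ^ 2) * b ^ 2 := mul_nonneg (by linarith) (sq_nonneg _)
  have k4 : 0 ≤ (2 * b * a - a * U) ^ 2 := sq_nonneg _
  nlinarith

/-- The majorant is nonnegative without any smallness of `a`. Its integral over good samples can
therefore be enlarged to all samples, where the covariance is known exactly. -/
theorem sq_add_bound_nonneg (U a b : ℝ) :
    0 ≤ U ^ 2 + 2 * U * b - 2 * U ^ 2 * a + 13 * b ^ 2 + 10 * U ^ 2 * a ^ 2 := by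
  nlinarith [sq_nonneg (U * (a - 1 / 10) * 3), sq_nonneg (U / 3 + 3 * b), sq_nonneg U, sq_nonneg b,
    sq_nonneg (U * (a - 1 / 10))]

theorem integral_five {α : Type*} [MeasurableSpace α] {μ : Measure α} [IsProbabilityMeasure μ]
    (c0 c1 c2 c3 c4 : ℝ) {f1 f2 f3 f4 : α → ℝ} (h1 : Integrable f1 μ) (h2 : Integrable f2 μ)
    (h3 : Integrable f3 μ) (h4 : Integrable f4 μ) :
    Integrable (fun x => c0 + c1 * f1 x - c2 * f2 x + c3 * f3 x + c4 * f4 x) μ ∧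
    ∫ x, (c0 + c1 * f1 x - c2 * f2 x + c3 * f3 x + c4 * f4 x) ∂μ =
      c0 + c1 * ∫ x, f1 x ∂μ - c2 * ∫ x, f2 x ∂μ + c3 * ∫ x, f3 x ∂μ + c4 * ∫ x, f4 x ∂μ := by
  have i1 := h1.const_mul c1
  have i2 := h2.const_mul c2
  have i3 := h3.const_mul c3
  have i4 := h4.const_mul c4
  have i0 : Integrable (fun _ : α => c0) μ := integrable_const _
  have j1 : Integrable (fun x => c0 + c1 * f1 x) μ := i0.add i1
  have j2 : Integrable (fun x => c0 + c1 * f1 x - c2 * f2 x) μ := j1.sub i2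
  have j3 : Integrable (fun x => c0 + c1 * f1 x - c2 * f2 x + c3 * f3 x) μ := j2.add i3
  refine ⟨j3.add i4, ?_⟩
  rw [integral_add j3 i4, integral_add j2 i3, integral_sub j1 i2, integral_add i0 i1]
  simp only [integral_const_mul, integral_const, probReal_univ, one_smul]

namespace SpectralMoments

variable {ι E : Type*} [Fintype ι] [NormedAddCommGroup E] [InnerProductSpace ℝ E]
    [MeasurableSpace E] [BorelSpace E] {e : OrthonormalBasis ι ℝ E} {lam : ι → ℝ} {μ : Measure E}

theorem cov_basis (h : SpectralMoments e lam μ) (k : ι) (w : E) :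
    ∫ x, inner ℝ (e k) x * inner ℝ w x ∂μ = lam k * inner ℝ (e k) w := by
  classical
  rw [h.cov, Finset.sum_eq_single k]
  · simp
  · intro b _ hb
    rw [e.inner_eq_ite, if_neg hb]; simp
  · simp

theorem integrable_sq_mul_sq (h : SpectralMoments e lam μ) (v w : E) :
    Integrable (fun x => inner ℝ v x ^ 2 * inner ℝ w x ^ 2) μ := h.integrable_mul_pow v w 1

theorem basis_sq_moment_le (h : SpectralMoments e lam μ) {l1 : ℝ} (hl : ∀ k, lam k ≤ l1)
    (k : ι) (w : E) :
    ∫ x, inner ℝ (e k) x ^ 2 * inner ℝ w x ^ 2 ∂μ ≤ 16 * (lam k * (l1 * ‖w‖ ^ 2)) := by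
  have := h.mul_moment_le (e k) w (j := 1) le_rfl
  rw [quad_basis] at this
  refine this.trans ?_
  have := mul_le_mul_of_nonneg_left (quad_le hl e w) (h.lam_nonneg k)
  norm_num
  nlinarith

/-- Since `⟨e o, w⟩ = 1`, the two linear terms average to `-2β(l1 - lam k)U²`. The term quadratic in
the denominator's perturbation costs at most `1/4 β(l1 - lam k)U²`, by `hk`, which leaves the rate
`7/4`. The remaining noise has constant `208 = 13 * 16`. -/
theorem lintegral_coord_sq_le [IsProbabilityMeasure μ] (h : SpectralMoments e lam μ) {l1 : ℝ}
    (hl : ∀ k, lam k ≤ l1) {o : ι} (ho : lam o = l1) {β Rmax : ℝ} (hβ : 0 < β) {m : ℕ}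
    (hm : 1 ≤ m) (k : ι) (hk : 640 * (β ^ 2 * l1 ^ 2 * Rmax) ≤ β * (l1 - lam k)) (w : E)
    (hw : inner ℝ (e o) w = 1) (hR : ‖w‖ ^ 2 ≤ Rmax) :
    ∫⁻ x in {x | (w, x) ∈ goodStep (e o) β m Rmax},
        ENNReal.ofReal (inner ℝ (e k) (ratioStep (e o) β w x) ^ 2) ∂μ ≤
      ENNReal.ofReal ((1 - 7 / 4 * (β * (l1 - lam k))) * inner ℝ (e k) w ^ 2
        + 208 * (β ^ 2 * (lam k * l1)) * ‖w‖ ^ 2) := by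
  set U := inner ℝ (e k) w with hU
  set q : E → ℝ := fun x => U ^ 2 + 2 * U * β * (inner ℝ (e k) x * inner ℝ w x)
    - 2 * U ^ 2 * β * (inner ℝ (e o) x * inner ℝ w x)
    + 13 * β ^ 2 * (inner ℝ (e k) x ^ 2 * inner ℝ w x ^ 2)
    + 10 * U ^ 2 * β ^ 2 * (inner ℝ (e o) x ^ 2 * inner ℝ w x ^ 2) with hq
  obtain ⟨hqi, hqe⟩ : Integrable q μ ∧ ∫ x, q x ∂μ = _ :=
    integral_five (U ^ 2) (2 * U * β) (2 * U ^ 2 * β) (13 * β ^ 2) (10 * U ^ 2 * β ^ 2)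
      (h.integrable_mul (e k) w) (h.integrable_mul (e o) w) (h.integrable_sq_mul_sq (e k) w)
      (h.integrable_sq_mul_sq (e o) w)
  have hq0 : ∀ x, 0 ≤ q x := fun x =>
    (sq_add_bound_nonneg U (β * (inner ℝ (e o) x * inner ℝ w x))
      (β * (inner ℝ (e k) x * inner ℝ w x))).trans (le_of_eq (by simp only [hq]; ring))
  have hint : ∫ x, q x ∂μ ≤ (1 - 7 / 4 * (β * (l1 - lam k))) * U ^ 2
        + 208 * (β ^ 2 * (lam k * l1)) * ‖w‖ ^ 2 := by
    rw [hqe, h.cov_basis, h.cov_basis, hw, ho, ← hU]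
    have b1 := mul_le_mul_of_nonneg_left (h.basis_sq_moment_le hl k w)
      (show 0 ≤ 13 * β ^ 2 by positivity)
    have b2 := mul_le_mul_of_nonneg_left (h.basis_sq_moment_le hl o w)
      (show 0 ≤ 10 * U ^ 2 * β ^ 2 by positivity)
    rw [ho] at b2
    have b3 : 160 * (β ^ 2 * l1 ^ 2 * ‖w‖ ^ 2) ≤ 1 / 4 * (β * (l1 - lam k)) := by
      have : β ^ 2 * l1 ^ 2 * ‖w‖ ^ 2 ≤ β ^ 2 * l1 ^ 2 * Rmax :=
        mul_le_mul_of_nonneg_left hR (by positivity)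
      linarith
    have b4 := mul_le_mul_of_nonneg_left b3 (sq_nonneg U)
    nlinarith
  calc _ ≤ ∫⁻ x in {x | (w, x) ∈ goodStep (e o) β m Rmax}, ENNReal.ofReal (q x) ∂μ := by
        refine setLIntegral_mono (by fun_prop) fun x hx => ENNReal.ofReal_le_ofReal ?_
        have ha : |β * (inner ℝ (e o) x * inner ℝ w x)| ≤ 1 / 8 := by
          have := hx.2.2.1
          have hm' : (1 : ℝ) ≤ m := by exact_mod_cast hm
          simp only at this
          nlinarith [abs_nonneg (β * (inner ℝ (e o) x * inner ℝ w x))]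
        have := sq_add_div_le (U := U) (b := β * (inner ℝ (e k) x * inner ℝ w x)) ha
        refine le_trans (le_of_eq ?_) (this.trans (le_of_eq ?_))
        · rw [ratioStep, inner_smul_right, inner_add_right, inner_smul_right]; ring
        · simp only [hq]; ring
    _ ≤ ∫⁻ x, ENNReal.ofReal (q x) ∂μ := setLIntegral_le_lintegral _ _
    _ = ENNReal.ofReal (∫ x, q x ∂μ) :=
        (ofReal_integral_eq_lintegral_ofReal hqi (Filter.Eventually.of_forall hq0)).symm
    _ ≤ _ := ENNReal.ofReal_le_ofReal hint

end SpectralMoments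

/-! ### High powers of the norm under one step. -/

theorem exp_le_quadratic {y a g s : ℝ} (hy : 0 ≤ y) (hy' : 8 * y ≤ 1) (hg : 0 ≤ g)
    (hg' : 4 * g ≤ 1) (ha : |a| ≤ 1 / 8) (hs : 0 ≤ s) (hs' : s ≤ 1 / 64) :
    Real.exp (2 * y - 2 * a + (g + 4 * s)) ≤
      1 + 2 * y - 2 * a + 16 * y ^ 2 + 16 * a ^ 2 + 12 * s + 3 * g := by
  obtain ⟨ha1, ha2⟩ := abs_le.1 ha
  have hexp := Real.abs_exp_sub_one_sub_id_le (x := 2 * y - 2 * a + (g + 4 * s)) (by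
    rw [abs_le]; constructor <;> linarith)
  have hexp' := (abs_le.1 hexp).2
  have hz : (g + 4 * s) ^ 2 ≤ g + 4 * s := by nlinarith
  nlinarith [sq_nonneg (2 * y - 2 * a - (g + 4 * s)), sq_nonneg (y + a)]

/-- Numerator and denominator are both bounded by exponentials, so the `m`-th power only multiplies
the exponent by `m`. The factors `m` in `goodStep` keep that exponent bounded by one in absolute
value, and `exp z ≤ 1 + z + z²` returns to a polynomial whose mean is computable. -/
theorem norm_ratioStep_pow_le {E : Type*} [NormedAddCommGroup E] [InnerProductSpace ℝ E]
    {e0 w x : E} {β Rmax : ℝ} {m : ℕ} (hβ : 0 < β) (hm : 1 ≤ m) (hw : w ≠ 0)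
    (hx : (w, x) ∈ goodStep e0 β m Rmax) :
    (‖ratioStep e0 β w x‖ ^ 2) ^ m ≤ (‖w‖ ^ 2) ^ m *
      (1 + 2 * m * β / ‖w‖ ^ 2 * (inner ℝ w x * inner ℝ w x)
        - 2 * m * β * (inner ℝ e0 x * inner ℝ w x)
        + 16 * m ^ 2 * β ^ 2 / (‖w‖ ^ 2) ^ 2 * (inner ℝ w x ^ 2 * inner ℝ w x ^ 2)
        + (16 * m ^ 2 * β ^ 2 + 12 * m * β ^ 2) * (inner ℝ e0 x ^ 2 * inner ℝ w x ^ 2)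
        + 3 * m * β ^ 2 / ‖w‖ ^ 2 * (inner ℝ w x ^ 2 * ‖x‖ ^ 2)) := by
  obtain ⟨-, -, h1, h2, h3⟩ := hx
  simp only at h1 h2 h3
  have hR : 0 < ‖w‖ ^ 2 := by positivity
  have hm' : (1 : ℝ) ≤ m := by exact_mod_cast hm
  have hnorm : ‖ratioStep e0 β w x‖ ^ 2
      = ((1 + β * (inner ℝ e0 x * inner ℝ w x))⁻¹ * (1 + 0)) ^ 2 *
        (‖w‖ ^ 2 + 2 * (β * inner ℝ w x ^ 2) + β ^ 2 * (inner ℝ w x ^ 2 * ‖x‖ ^ 2)) := by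
    rw [ratioStep, norm_smul, mul_pow, Real.norm_eq_abs, sq_abs, norm_add_sq_real, norm_smul,
      mul_pow, Real.norm_eq_abs, sq_abs, inner_smul_right]
    ring
  set R := ‖w‖ ^ 2 with hRdef
  set Y := inner ℝ w x with hY
  set a := β * (inner ℝ e0 x * Y) with ha
  set g := β ^ 2 * (Y ^ 2 * ‖x‖ ^ 2) / R with hg
  set y := β * Y ^ 2 / R with hy
  have hy0 : 0 ≤ y := by positivity
  have hg0 : 0 ≤ g := by positivity
  have hmy : 8 * m * y ≤ 1 := by
    rw [hy, ← mul_div_assoc, div_le_one hR]; exact h2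
  have hmg : 4 * m * g ≤ 1 := by
    rw [hg, ← mul_div_assoc, div_le_one hR]; exact h3
  have ha8 : |a| ≤ 1 / 8 := by nlinarith [abs_nonneg a]
  have hma : |m * a| ≤ 1 / 8 := by
    rw [abs_mul, abs_of_nonneg (by linarith)]; linarith
  have hma2 : m * a ^ 2 ≤ 1 / 64 := by
    have h4 : (m * a) ^ 2 ≤ 1 / 64 := by
      rw [← sq_abs]; nlinarith [abs_nonneg (m * a)]
    nlinarith [mul_nonneg (sub_nonneg.2 hm') (mul_nonneg (show (0 : ℝ) ≤ m by linarith) (sq_nonneg a))]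
  have hbase : ‖ratioStep e0 β w x‖ ^ 2 ≤ R * Real.exp (2 * y - 2 * a + (g + 4 * a ^ 2)) := by
    have k2 : ((1 + a)⁻¹ * (1 + 0)) ^ 2 ≤ Real.exp (-2 * a + 4 * a ^ 2) := by
      have k3 := inv_one_add_sq_le ha8
      have := Real.add_one_le_exp (-2 * a + 4 * a ^ 2)
      rw [add_zero, mul_one]; linarith
    have k4 : R + 2 * (β * Y ^ 2) + β ^ 2 * (Y ^ 2 * ‖x‖ ^ 2) ≤ R * Real.exp (2 * y + g) := by
      have := mul_le_mul_of_nonneg_left (Real.add_one_le_exp (2 * y + g)) hR.le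
      refine le_trans (le_of_eq ?_) this
      rw [hy, hg]; field_simp; ring
    rw [hnorm]
    calc _ ≤ Real.exp (-2 * a + 4 * a ^ 2) * (R * Real.exp (2 * y + g)) :=
          mul_le_mul k2 k4 (by positivity) (Real.exp_pos _).le
      _ = R * (Real.exp (-2 * a + 4 * a ^ 2) * Real.exp (2 * y + g)) := by ring
      _ = _ := by rw [← Real.exp_add]; congr 2; ring
  refine (pow_le_pow_left₀ (by positivity) hbase m).trans ?_
  rw [mul_pow, ← Real.exp_nat_mul]
  refine mul_le_mul_of_nonneg_left ?_ (by positivity)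
  have key := exp_le_quadratic (y := m * y) (a := m * a) (g := m * g) (s := m * a ^ 2)
    (by positivity) (by linarith) (by positivity) (by linarith) hma (by positivity) hma2
  refine le_trans (le_of_eq ?_) (key.trans (le_of_eq ?_))
  · congr 1; ring
  · rw [hy, hg, ha]; field_simp; ring

/-- For `R ≥ 2` one has `1 - 1/R ≥ 1/2`, so the drift dominates the second-order terms and `I ≤ 1`.
For `R < 2` the drift may vanish, but then `R ^ m ≤ 2 ^ m` and `I ≤ 2`, which accounts for the
additive term. -/
theorem pow_mul_le_of_drift {m : ℕ} {R Rmax β g c d I : ℝ} (hm' : (1 : ℝ) ≤ m) (hR1 : 1 ≤ R)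
    (hR : R ≤ Rmax) (hI0 : 0 ≤ I) (hc : 0 ≤ c) (hβ : 0 ≤ β) (hg : 0 ≤ g)
    (h1 : c * (704 * m * Rmax + 48 * d) ≤ g) (h2 : m * (β * g) ≤ 1)
    (hI : I ≤ 1 - 2 * m * β * g * (1 - 1 / R)
      + m * β * (c * (256 * m + 256 * m * R + 192 * R + 48 * d))) :
    R ^ m * I ≤ R ^ m + 2 * 2 ^ m := by
  have hR0 : 0 < R := by linarith
  have hmβ : 0 ≤ m * β := by positivity
  have hmR : m * 1 ≤ m * R := mul_le_mul_of_nonneg_left hR1 (by linarith)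
  have hmR' : 1 * R ≤ m * R := mul_le_mul_of_nonneg_right hm' (by linarith)
  have hmRm : m * R ≤ m * Rmax := mul_le_mul_of_nonneg_left hR (by linarith)
  have v1 : c * (256 * m + 256 * m * R + 192 * R + 48 * d) ≤ g :=
    (mul_le_mul_of_nonneg_left (by linarith) hc).trans h1
  have v3 := mul_le_mul_of_nonneg_left v1 hmβ
  rcases le_or_gt 2 R with h2R | h2R
  · have v2 : 1 / R ≤ 1 / 2 := one_div_le_one_div_of_le (by norm_num) h2R
    have v4 : 2 * m * β * g * (1 / 2) ≤ 2 * m * β * g * (1 - 1 / R) :=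
      mul_le_mul_of_nonneg_left (by linarith) (by positivity)
    have v5 : I ≤ 1 := by linarith
    have v6 := mul_le_mul_of_nonneg_left v5 (show 0 ≤ R ^ m by positivity)
    have : (0 : ℝ) < 2 * 2 ^ m := by positivity
    linarith
  · have v2 : 1 / R ≤ 1 := by rw [div_le_one hR0]; exact hR1
    have v4 : 0 ≤ 2 * m * β * g * (1 - 1 / R) := mul_nonneg (by positivity) (by linarith)
    have v5 : I ≤ 2 := by linarith
    have v6 : R ^ m * I ≤ 2 ^ m * 2 :=
      mul_le_mul (pow_le_pow_left₀ hR0.le h2R.le m) v5 hI0 (by positivity)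
    have : (0 : ℝ) < R ^ m := by positivity
    linarith

/-! ### Probability of a bad sample, and one-step growth of norm moments. -/

/-- Markov's inequality for the `m`-th power: a threshold four times the moment scale gives `4⁻ᵐ ≤
e⁻ᵐ`. -/
theorem measure_gt_le_exp_of_moment {α : Type*} [MeasurableSpace α] {μ : Measure α}
    [IsProbabilityMeasure μ] {f : α → ℝ} (hf : ∀ x, 0 ≤ f x) {m : ℕ} {A K c : ℝ}
    (hi : Integrable (fun x => f x ^ m) μ) (hA : ∫ x, f x ^ m ∂μ ≤ A ^ m) (hA0 : 0 ≤ A)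
    (hK : 0 < K) (hc : 0 < c) (h : 4 * (K * A) ≤ c) :
    μ {x | c < K * f x} ≤ ENNReal.ofReal (Real.exp (-m)) := by
  have h1 := mul_meas_ge_le_integral_of_nonneg
    (Filter.Eventually.of_forall fun x => pow_nonneg (hf x) m) hi ((c / K) ^ m)
  have h2 : A ^ m ≤ (c / K) ^ m * Real.exp (-m) := by
    have : Real.exp (-(m : ℝ)) = Real.exp (-1) ^ m := by rw [← Real.exp_nat_mul]; ring_nf
    rw [this, ← mul_pow]
    refine pow_le_pow_left₀ hA0 ?_ m
    have h3 : 1 / 4 ≤ Real.exp (-1) := by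
      rw [Real.exp_neg, one_div]
      exact inv_anti₀ (Real.exp_pos _) (by linarith [Real.exp_one_lt_d9])
    have h4 : A ≤ c / K * (1 / 4) := by
      rw [div_mul_eq_mul_div, le_div_iff₀ hK]; linarith
    exact h4.trans (mul_le_mul_of_nonneg_left h3 (by positivity))
  have h5 : μ.real {x | (c / K) ^ m ≤ f x ^ m} ≤ Real.exp (-m) :=
    le_of_mul_le_mul_left ((h1.trans hA).trans h2) (by positivity)
  have h6 : {x | c < K * f x} ⊆ {x | (c / K) ^ m ≤ f x ^ m} := fun x hx => by
    have h7 : c < K * f x := hx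
    exact pow_le_pow_left₀ (div_nonneg hc.le hK.le) (by rw [div_le_iff₀ hK]; linarith) m
  refine (measure_mono h6).trans ?_
  rw [← ofReal_measureReal]
  exact ENNReal.ofReal_le_ofReal h5

namespace SpectralMoments

variable {ι E : Type*} [Fintype ι] [NormedAddCommGroup E] [InnerProductSpace ℝ E]
    [MeasurableSpace E] [BorelSpace E] {e : OrthonormalBasis ι ℝ E} {lam : ι → ℝ} {μ : Measure E}

theorem norm_sq_eq_sum (e : OrthonormalBasis ι ℝ E) (x : E) :
    ‖x‖ ^ 2 = ∑ k, inner ℝ (e k) x ^ 2 := by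
  rw [← e.sum_sq_norm_inner_right x]; simp

/-- The power mean inequality over the coordinates of `x` reduces this to products of two
projections; the dimension enters only linearly inside the `m`-th power. -/
theorem integrable_sq_mul_norm_sq_pow (h : SpectralMoments e lam μ) [Nonempty ι] {l1 : ℝ}
    (hl : ∀ k, lam k ≤ l1) (w : E) {m : ℕ} (hm : 1 ≤ m) :
    Integrable (fun x => (inner ℝ w x ^ 2 * ‖x‖ ^ 2) ^ m) μ ∧
    ∫ x, (inner ℝ w x ^ 2 * ‖x‖ ^ 2) ^ m ∂μ
      ≤ (16 * m ^ 2 * Fintype.card ι * l1 ^ 2 * ‖w‖ ^ 2) ^ m := by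
  set d : ℝ := ((Fintype.card ι : ℕ) : ℝ) with hd
  have hd0 : 0 < d := by rw [hd]; exact_mod_cast Fintype.card_pos
  have hl1 : 0 ≤ l1 := (h.lam_nonneg (Classical.arbitrary ι)).trans (hl _)
  set g : E → ℝ := fun x => d ^ (m - 1) *
    ∑ k, inner ℝ (e k) x ^ (2 * m) * inner ℝ w x ^ (2 * m) with hg
  have hgi : Integrable g μ :=
    (integrable_finsetSum _ fun k _ => h.integrable_mul_pow (e k) w m).const_mul _
  have hle : ∀ x, (inner ℝ w x ^ 2 * ‖x‖ ^ 2) ^ m ≤ g x := by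
    intro x
    obtain ⟨n, rfl⟩ : ∃ n, m = n + 1 := ⟨m - 1, by omega⟩
    have h1 := pow_sum_div_card_le_sum_pow (s := Finset.univ)
      (f := fun k => inner ℝ (e k) x ^ 2) (fun k _ => sq_nonneg _) n
    rw [div_le_iff₀ (by rw [Finset.card_univ, ← hd]; positivity), Finset.card_univ, ← hd,
      ← norm_sq_eq_sum] at h1
    rw [mul_pow]
    refine (mul_le_mul_of_nonneg_left h1 (by positivity)).trans (le_of_eq ?_)
    simp only [hg, Nat.add_sub_cancel]
    rw [← mul_assoc, Finset.mul_sum, Finset.sum_mul, Finset.mul_sum]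
    refine Finset.sum_congr rfl fun k _ => ?_
    rw [pow_mul, pow_mul]; ring
  have hi : Integrable (fun x => (inner ℝ w x ^ 2 * ‖x‖ ^ 2) ^ m) μ :=
    hgi.mono' (by fun_prop) (Filter.Eventually.of_forall fun x => by
      rw [Real.norm_eq_abs, abs_of_nonneg (by positivity)]; exact hle x)
  refine ⟨hi, (integral_mono hi hgi hle).trans ?_⟩
  simp only [hg]
  rw [integral_const_mul, integral_finsetSum _ fun k _ => h.integrable_mul_pow (e k) w m]
  have h2 : ∀ k, ∫ x, inner ℝ (e k) x ^ (2 * m) * inner ℝ w x ^ (2 * m) ∂μ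
      ≤ (4 * m) ^ (2 * m) * (l1 ^ m * (l1 * ‖w‖ ^ 2) ^ m) := by
    intro k
    refine (h.mul_moment_le (e k) w hm).trans ?_
    rw [quad_basis]
    have := h.lam_nonneg k
    have := h.quad_nonneg w
    gcongr
    · exact hl k
    · exact quad_le hl e w
  refine (mul_le_mul_of_nonneg_left (Finset.sum_le_sum fun k _ => h2 k) (by positivity)).trans ?_
  rw [Finset.sum_const, Finset.card_univ, nsmul_eq_mul, ← hd, ← mul_assoc, ← pow_succ,
    show m - 1 + 1 = m by omega, pow_mul, ← mul_pow, ← mul_pow, ← mul_pow]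
  refine le_of_eq ?_
  congr 1; ring

/-- Each of the three smallness conditions on the sample fails with probability at most `e⁻ᵐ`. The
hypotheses `h1`, `h2`, `h3` are the corresponding threshold conditions of
`measure_gt_le_exp_of_moment`, the first after squaring. -/
theorem measure_not_goodStep_le [IsProbabilityMeasure μ] (h : SpectralMoments e lam μ) [Nonempty ι]
    {l1 : ℝ} (hl : ∀ k, lam k ≤ l1) (o : ι) {β Rmax : ℝ} (hβ : 0 < β) {m : ℕ}
    (hm : 1 ≤ m) (h1 : 4096 * (m ^ 4 * (β ^ 2 * l1 ^ 2 * Rmax)) ≤ 1)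
    (h2 : 64 * (m ^ 2 * (β * l1)) ≤ 1) (h3 : 256 * (m ^ 3 * (β ^ 2 * l1 ^ 2) * Fintype.card ι) ≤ 1)
    (w : E) (hw : inner ℝ (e o) w = 1) (hR : ‖w‖ ^ 2 ≤ Rmax) :
    μ {x | (w, x) ∉ goodStep (e o) β m Rmax} ≤ 3 * ENNReal.ofReal (Real.exp (-m)) := by
  have hm0 : (0 : ℝ) < m := by exact_mod_cast hm
  have hl1 : 0 ≤ l1 := (h.lam_nonneg o).trans (hl _)
  have hw0 : w ≠ 0 := by rintro rfl; simp at hw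
  have hR0 : 0 < ‖w‖ ^ 2 := by positivity
  have s1 : μ {x | 1 < (8 * m * β) ^ 2 * (inner ℝ (e o) x ^ 2 * inner ℝ w x ^ 2)}
      ≤ ENNReal.ofReal (Real.exp (-m)) := by
    refine measure_gt_le_exp_of_moment (A := (4 * m) ^ 2 * (l1 * (l1 * ‖w‖ ^ 2)))
      (fun x => by positivity) ?_ ?_ (by positivity) (by positivity) one_pos ?_
    · refine (h.integrable_mul_pow (e o) w m).congr (Filter.Eventually.of_forall fun x => ?_)
      simp only; rw [mul_pow, pow_mul, pow_mul]
    · have := h.mul_moment_le (e o) w hm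
      rw [quad_basis] at this
      have q0 := h.quad_nonneg w
      have l0 := h.lam_nonneg o
      calc _ = ∫ x, inner ℝ (e o) x ^ (2 * m) * inner ℝ w x ^ (2 * m) ∂μ := by
            congr 1; ext x; rw [mul_pow, pow_mul, pow_mul]
        _ ≤ _ := this
        _ ≤ (4 * m) ^ (2 * m) * (l1 ^ m * (l1 * ‖w‖ ^ 2) ^ m) := by
            gcongr
            · exact hl o
            · exact quad_le hl e w
        _ = _ := by rw [pow_mul, ← mul_pow, ← mul_pow]
    · have : m ^ 4 * (β ^ 2 * l1 ^ 2 * ‖w‖ ^ 2) ≤ m ^ 4 * (β ^ 2 * l1 ^ 2 * Rmax) := by gcongr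
      nlinarith
  have s2 : μ {x | ‖w‖ ^ 2 < (8 * m * β) * inner ℝ w x ^ 2}
      ≤ ENNReal.ofReal (Real.exp (-m)) := by
    refine measure_gt_le_exp_of_moment (A := 2 * m * (l1 * ‖w‖ ^ 2))
      (fun x => by positivity) ?_ ?_ (by positivity) (by positivity) hR0 ?_
    · refine (h.integrable_pow w m).congr (Filter.Eventually.of_forall fun x => ?_)
      simp only; rw [pow_mul]
    · have := h.moment_le w m hm
      have q0 := h.quad_nonneg w
      calc _ = ∫ x, inner ℝ w x ^ (2 * m) ∂μ := by
            congr 1; ext x; rw [pow_mul]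
        _ ≤ _ := this
        _ ≤ (2 * m) ^ m * (l1 * ‖w‖ ^ 2) ^ m := by
            gcongr
            exact quad_le hl e w
        _ = _ := by rw [← mul_pow]
    · have := mul_le_mul_of_nonneg_right h2 hR0.le
      nlinarith
  have s3 : μ {x | ‖w‖ ^ 2 < (4 * m * β ^ 2) * (inner ℝ w x ^ 2 * ‖x‖ ^ 2)}
      ≤ ENNReal.ofReal (Real.exp (-m)) := by
    obtain ⟨i1, i2⟩ := h.integrable_sq_mul_norm_sq_pow hl w hm
    refine measure_gt_le_exp_of_moment (fun x => by positivity) i1 i2 (by positivity)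
      (by positivity) hR0 ?_
    have := mul_le_mul_of_nonneg_right h3 hR0.le
    nlinarith
  have hsub : {x | (w, x) ∉ goodStep (e o) β m Rmax} ⊆
      ({x | 1 < (8 * m * β) ^ 2 * (inner ℝ (e o) x ^ 2 * inner ℝ w x ^ 2)} ∪
        {x | ‖w‖ ^ 2 < (8 * m * β) * inner ℝ w x ^ 2}) ∪
      {x | ‖w‖ ^ 2 < (4 * m * β ^ 2) * (inner ℝ w x ^ 2 * ‖x‖ ^ 2)} := by
    intro x hx
    by_contra hcon
    simp only [Set.mem_union, Set.mem_ofPred_eq, not_or, not_lt] at hcon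
    obtain ⟨⟨c1, c2⟩, c3⟩ := hcon
    refine hx ⟨hw, hR, ?_, by simpa only [mul_assoc] using c2, by simpa only [mul_assoc] using c3⟩
    have : (8 * m * |β * (inner ℝ (e o) x * inner ℝ w x)|) ^ 2 ≤ 1 := by
      rw [mul_pow, sq_abs]; refine le_trans (le_of_eq ?_) c1; ring
    exact (sq_le_one_iff₀ (by positivity)).1 this
  calc _ ≤ _ := measure_mono hsub
    _ ≤ _ := (measure_union_le _ _).trans (add_le_add (measure_union_le _ _) le_rfl)
    _ ≤ _ := add_le_add (add_le_add s1 s2) s3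
    _ = _ := by ring

theorem lintegral_norm_pow_le [IsProbabilityMeasure μ] (h : SpectralMoments e lam μ) [Nonempty ι]
    {l1 l2 : ℝ} {o : ι} (ho : lam o = l1) (hl2 : ∀ k ≠ o, lam k ≤ l2) (hl : ∀ k, lam k ≤ l1)
    {β Rmax : ℝ} (hβ : 0 < β) {m : ℕ} (hm : 1 ≤ m)
    (h1 : β * l1 ^ 2 * (704 * m * Rmax + 48 * Fintype.card ι) ≤ l1 - l2)
    (h2 : m * (β * (l1 - l2)) ≤ 1) (w : E)
    (hw : inner ℝ (e o) w = 1) (hR : ‖w‖ ^ 2 ≤ Rmax) :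
    ∫⁻ x in {x | (w, x) ∈ goodStep (e o) β m Rmax},
        ENNReal.ofReal ((‖ratioStep (e o) β w x‖ ^ 2) ^ m) ∂μ ≤
      ENNReal.ofReal ((‖w‖ ^ 2) ^ m + 2 * 2 ^ m) := by
  have hm' : (1 : ℝ) ≤ m := by exact_mod_cast hm
  have hl1 : 0 ≤ l1 := (h.lam_nonneg o).trans (hl _)
  have hw0 : w ≠ 0 := by rintro rfl; simp at hw
  have hR1 : 1 ≤ ‖w‖ ^ 2 := by
    rw [norm_sq_eq_sum e w]
    refine le_trans (le_of_eq ?_)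
      (Finset.single_le_sum (fun k _ => sq_nonneg (inner ℝ (e k) w)) (Finset.mem_univ o))
    rw [hw]; norm_num
  have hR0 : 0 < ‖w‖ ^ 2 := by linarith
  set R := ‖w‖ ^ 2 with hRdef
  set d : ℝ := ((Fintype.card ι : ℕ) : ℝ) with hd
  set f : E → ℝ := fun x => 1 + 2 * m * β / R * (inner ℝ w x * inner ℝ w x)
        - 2 * m * β * (inner ℝ (e o) x * inner ℝ w x)
        + 16 * m ^ 2 * β ^ 2 / R ^ 2 * (inner ℝ w x ^ 2 * inner ℝ w x ^ 2)
        + (16 * m ^ 2 * β ^ 2 + 12 * m * β ^ 2) * (inner ℝ (e o) x ^ 2 * inner ℝ w x ^ 2) with hf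
  set q : E → ℝ := fun x => f x + 3 * m * β ^ 2 / R * (inner ℝ w x ^ 2 * ‖x‖ ^ 2) with hq
  obtain ⟨hfi, hfe⟩ : Integrable f μ ∧ ∫ x, f x ∂μ = _ :=
    integral_five _ _ _ _ _ (h.integrable_mul w w) (h.integrable_mul (e o) w)
      (h.integrable_sq_mul_sq w w) (h.integrable_sq_mul_sq (e o) w)
  obtain ⟨n1, n2⟩ := h.integrable_sq_mul_norm_sq_pow hl w (m := 1) le_rfl
  simp only [pow_one, Nat.cast_one, one_pow, mul_one] at n1 n2
  have hqi : Integrable q μ := hfi.add (n1.const_mul _)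
  have hqe : ∫ x, q x ∂μ = ∫ x, f x ∂μ
      + 3 * m * β ^ 2 / R * ∫ x, inner ℝ w x ^ 2 * ‖x‖ ^ 2 ∂μ := by
    simp only [hq]; rw [integral_add hfi (n1.const_mul _), integral_const_mul]
  have hq0 : ∀ x, 0 ≤ q x := by
    intro x
    have e1 : f x = 1 + 2 * (m * (β * inner ℝ w x ^ 2 / R))
        - 2 * (m * (β * (inner ℝ (e o) x * inner ℝ w x)))
        + 16 * (m * (β * inner ℝ w x ^ 2 / R)) ^ 2
        + 16 * (m * (β * (inner ℝ (e o) x * inner ℝ w x))) ^ 2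
        + 12 * m * (β * (inner ℝ (e o) x * inner ℝ w x)) ^ 2 := by
      simp only [hf]; field_simp; ring
    have e2 : 0 ≤ 3 * m * β ^ 2 / R * (inner ℝ w x ^ 2 * ‖x‖ ^ 2) := by positivity
    have e3 : 0 ≤ 12 * m * (β * (inner ℝ (e o) x * inner ℝ w x)) ^ 2 := by positivity
    simp only [hq]
    rw [e1]
    nlinarith [sq_nonneg (4 * (m * (β * inner ℝ w x ^ 2 / R)) + 1 / 4),
      sq_nonneg (4 * (m * (β * (inner ℝ (e o) x * inner ℝ w x))) - 1 / 4)]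
  -- Here the gap enters: the `o`-coordinate of `w` is one, so mass `R - 1` lies on eigenvalues at
  -- most `l2`.
  have hY2 : ∫ x, inner ℝ w x * inner ℝ w x ∂μ ≤ l1 * R - (l1 - l2) * (R - 1) := by
    classical
    rw [h.cov, hRdef, norm_sq_eq_sum e w, ← Finset.add_sum_erase _ _ (Finset.mem_univ o),
      ← Finset.add_sum_erase _ (fun k => inner ℝ (e k) w ^ 2) (Finset.mem_univ o), ho, hw]
    have : ∑ k ∈ Finset.univ.erase o, lam k * (inner ℝ (e k) w * inner ℝ (e k) w)
        ≤ l2 * ∑ k ∈ Finset.univ.erase o, inner ℝ (e k) w ^ 2 := by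
      rw [Finset.mul_sum]
      refine Finset.sum_le_sum fun k hk => ?_
      rw [← pow_two]
      exact mul_le_mul_of_nonneg_right (hl2 k (Finset.ne_of_mem_erase hk)) (sq_nonneg _)
    nlinarith
  have hY4 : ∫ x, inner ℝ w x ^ 2 * inner ℝ w x ^ 2 ∂μ ≤ 16 * (l1 * R) ^ 2 := by
    have := h.mul_moment_le w w (j := 1) le_rfl
    have q1 := quad_le hl e w
    have q0 := h.quad_nonneg w
    norm_num at this
    nlinarith
  have ha := h.basis_sq_moment_le hl o w
  rw [ho] at ha
  have hint : ∫ x, q x ∂μ ≤ 1 - 2 * m * β * (l1 - l2) * (1 - 1 / R)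
      + m * β * (β * l1 ^ 2 * (256 * m + 256 * m * R + 192 * R + 48 * d)) := by
    rw [hqe, hfe, h.cov_basis, hw, ho]
    have t1 := mul_le_mul_of_nonneg_left hY2 (show 0 ≤ 2 * m * β / R by positivity)
    have t2 := mul_le_mul_of_nonneg_left hY4 (show 0 ≤ 16 * m ^ 2 * β ^ 2 / R ^ 2 by positivity)
    have t3 := mul_le_mul_of_nonneg_left ha
      (show 0 ≤ 16 * m ^ 2 * β ^ 2 + 12 * m * β ^ 2 by positivity)
    have t4 := mul_le_mul_of_nonneg_left n2 (show 0 ≤ 3 * m * β ^ 2 / R by positivity)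
    have u1 : 2 * m * β / R * (l1 * R - (l1 - l2) * (R - 1))
        = 2 * m * β * l1 - 2 * m * β * (l1 - l2) * (1 - 1 / R) := by field_simp
    have u2 : 16 * m ^ 2 * β ^ 2 / R ^ 2 * (16 * (l1 * R) ^ 2)
        = 256 * m ^ 2 * β ^ 2 * l1 ^ 2 := by field_simp; ring
    have u4 : 3 * m * β ^ 2 / R * (16 * d * l1 ^ 2 * R) = 48 * m * β ^ 2 * d * l1 ^ 2 := by
      field_simp; ring
    rw [u1] at t1; rw [u2] at t2; rw [← hd, u4] at t4
    linarith
  have hRmax : 0 ≤ Rmax := by linarith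
  have hg0 : 0 ≤ l1 - l2 := le_trans (by positivity) h1
  have hfin : R ^ m * ∫ x, q x ∂μ ≤ R ^ m + 2 * 2 ^ m :=
    pow_mul_le_of_drift hm' hR1 hR (integral_nonneg hq0) (by positivity) hβ.le hg0 h1 h2 hint
  calc _ ≤ ∫⁻ x in {x | (w, x) ∈ goodStep (e o) β m Rmax}, ENNReal.ofReal (R ^ m * q x) ∂μ :=
        setLIntegral_mono (by fun_prop) fun x hx => ENNReal.ofReal_le_ofReal
          (norm_ratioStep_pow_le hβ hm hw0 hx)
    _ ≤ ∫⁻ x, ENNReal.ofReal (R ^ m * q x) ∂μ := setLIntegral_le_lintegral _ _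
    _ = ENNReal.ofReal (∫ x, R ^ m * q x ∂μ) :=
        (ofReal_integral_eq_lintegral_ofReal (hqi.const_mul _)
          (Filter.Eventually.of_forall fun x => mul_nonneg (by positivity) (hq0 x))).symm
    _ ≤ _ := ENNReal.ofReal_le_ofReal (by rw [integral_const_mul]; exact hfin)

end SpectralMoments

/-! ### Chains driven by independent samples, stopped at the first bad transition. -/

theorem setLIntegral_comp_prodMk_of_indep {Ω E F : Type*} {m' m0 : MeasurableSpace Ω}
    [MeasurableSpace E] [MeasurableSpace F] {P : Measure Ω} [IsProbabilityMeasure P] (hm : m' ≤ m0)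
    {W : Ω → E} {A : Set Ω} {Y : Ω → F} (hW : Measurable[m'] W) (hA : MeasurableSet[m'] A)
    (hY : Measurable Y) (hind : Indep m' (MeasurableSpace.comap Y inferInstance) P)
    {f : E × F → ℝ≥0∞} (hf : Measurable f) :
    ∫⁻ ω in A, f (W ω, Y ω) ∂P = ∫⁻ ω in A, ∫⁻ y, f (W ω, y) ∂(P.map Y) ∂P := by
  -- Carrying the indicator of `A` as a coordinate makes the restriction part of the past, so
  -- independence and Fubini apply directly.
  set V : Ω → E × ℝ≥0∞ := fun ω => (W ω, A.indicator (fun _ => 1) ω) with hV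
  have hVm' : Measurable[m'] V := hW.prodMk (measurable_const.indicator hA)
  have hVm : Measurable V := hVm'.mono hm le_rfl
  have hVY : IndepFun V Y P := indep_of_indep_of_le_left hind hVm'.comap_le
  have hg : Measurable (fun p : (E × ℝ≥0∞) × F => p.1.2 * f (p.1.1, p.2)) := by fun_prop
  have h1 : ∫⁻ ω, (V ω).2 * f ((V ω).1, Y ω) ∂P
      = ∫⁻ ω, ∫⁻ y, (V ω).2 * f ((V ω).1, y) ∂(P.map Y) ∂P := by
    have : IsProbabilityMeasure (P.map Y) := Measure.isProbabilityMeasure_map hY.aemeasurable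
    calc _ = ∫⁻ p, p.1.2 * f (p.1.1, p.2) ∂(P.map fun ω => (V ω, Y ω)) :=
          (lintegral_map hg (hVm.prodMk hY)).symm
      _ = ∫⁻ p, p.1.2 * f (p.1.1, p.2) ∂((P.map V).prod (P.map Y)) := by
          rw [hVY.map_prod_eq_prod_map_map hVm.aemeasurable hY.aemeasurable]
      _ = ∫⁻ v, ∫⁻ y, v.2 * f (v.1, y) ∂(P.map Y) ∂(P.map V) :=
          lintegral_prod _ hg.aemeasurable
      _ = _ := lintegral_map hg.lintegral_prod_right' hVm
  rw [← lintegral_indicator (hm _ hA), ← lintegral_indicator (hm _ hA)]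
  convert h1 using 1
  · congr 1; ext ω
    by_cases h : ω ∈ A <;> simp [hV, h]
  · congr 1; ext ω
    by_cases h : ω ∈ A <;> simp [hV, h]

/-- The Markov chain driven by `X` with transition function `step`. -/
def drivenChain {Ω E F : Type*} (step : E × F → E) (w0 : E) (X : ℕ → Ω → F) : ℕ → Ω → E
  | 0 => fun _ => w0
  | n + 1 => fun ω => step (drivenChain step w0 X n ω, X n ω)

/-- The event that the first `n` transitions of the chain belong to `G`. -/
def survival {Ω E F : Type*} (step : E × F → E) (w0 : E) (X : ℕ → Ω → F) (G : Set (E × F))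
    (n : ℕ) : Set Ω :=
  {ω | ∀ i < n, (drivenChain step w0 X i ω, X i ω) ∈ G}

section Chain

variable {Ω E F : Type*} [MeasurableSpace Ω] [MeasurableSpace E] [MeasurableSpace F]
  {P : Measure Ω} [IsProbabilityMeasure P] {step : E × F → E} {w0 : E} {X : ℕ → Ω → F}
  {G : Set (E × F)} {μ : Measure F}

theorem survival_succ (n : ℕ) : survival step w0 X G (n + 1) =
    survival step w0 X G n ∩ {ω | (drivenChain step w0 X n ω, X n ω) ∈ G} := by
  ext ω
  simp only [survival, Set.mem_ofPred_eq, Set.mem_inter_iff, Nat.lt_succ_iff_lt_or_eq]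
  constructor
  · exact fun h => ⟨fun i hi => h i (Or.inl hi), h n (Or.inr rfl)⟩
  · rintro ⟨h1, h2⟩ i (hi | rfl)
    exacts [h1 i hi, h2]

theorem survival_antitone : Antitone (survival step w0 X G) :=
  fun _ _ hmn _ h i hi => h i (hi.trans_le hmn)

theorem measurable_past (hX : ∀ n, Measurable (X n)) (n : ℕ) :
    (⨆ j ∈ Set.Iio n, MeasurableSpace.comap (X j) inferInstance) ≤ ‹MeasurableSpace Ω› :=
  iSup₂_le fun j _ => (hX j).comap_le

theorem measurable_drivenChain (hstep : Measurable step) (n : ℕ) :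
    Measurable[⨆ j ∈ Set.Iio n, MeasurableSpace.comap (X j) inferInstance]
      (drivenChain step w0 X n) := by
  induction n with
  | zero => exact measurable_const
  | succ n ih =>
    refine hstep.comp (Measurable.prodMk (ih.mono ?_ le_rfl) ((comap_measurable (X n)).mono ?_ le_rfl))
    · exact biSup_mono fun i hi => lt_trans (Set.mem_Iio.1 hi) n.lt_succ_self
    · exact le_iSup₂_of_le n (Set.mem_Iio.2 n.lt_succ_self) le_rfl

theorem measurableSet_survival (hstep : Measurable step) (hG : MeasurableSet G) (n : ℕ) :
    MeasurableSet[⨆ j ∈ Set.Iio n, MeasurableSpace.comap (X j) inferInstance]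
      (survival step w0 X G n) := by
  induction n with
  | zero => simp [survival]
  | succ n ih =>
    have hle : (⨆ j ∈ Set.Iio n, MeasurableSpace.comap (X j) inferInstance)
        ≤ ⨆ j ∈ Set.Iio (n + 1), MeasurableSpace.comap (X j) inferInstance :=
      biSup_mono fun i hi => lt_trans (Set.mem_Iio.1 hi) n.lt_succ_self
    rw [survival_succ]
    refine MeasurableSet.inter (hle _ ih) (Measurable.prodMk
      ((measurable_drivenChain hstep n).mono hle le_rfl)
      ((comap_measurable (X n)).mono ?_ le_rfl) hG)
    exact le_iSup₂_of_le n (Set.mem_Iio.2 n.lt_succ_self) le_rfl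

theorem indep_past (hX : ∀ n, Measurable (X n)) (hind : iIndepFun X P) (n : ℕ) :
    Indep (⨆ j ∈ Set.Iio n, MeasurableSpace.comap (X j) inferInstance)
      (MeasurableSpace.comap (X n) inferInstance) P := by
  have := indep_iSup_of_disjoint (fun i => (hX i).comap_le) hind
    (S := Set.Iio n) (T := {n}) (by simp)
  simpa using this

theorem setLIntegral_survival (hX : ∀ n, Measurable (X n)) (hind : iIndepFun X P)
    (hlaw : ∀ n, P.map (X n) = μ) (hstep : Measurable step) (hG : MeasurableSet G) (n : ℕ)
    {f : E × F → ℝ≥0∞} (hf : Measurable f) :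
    ∫⁻ ω in survival step w0 X G n, f (drivenChain step w0 X n ω, X n ω) ∂P =
      ∫⁻ ω in survival step w0 X G n, ∫⁻ x, f (drivenChain step w0 X n ω, x) ∂μ ∂P := by
  rw [← hlaw n]
  exact setLIntegral_comp_prodMk_of_indep (measurable_past hX n) (measurable_drivenChain hstep n)
    (measurableSet_survival hstep hG n) (hX n) (indep_past hX hind n) hf

theorem setLIntegral_survival_succ (hX : ∀ n, Measurable (X n)) (hind : iIndepFun X P)
    (hlaw : ∀ n, P.map (X n) = μ) (hstep : Measurable step) (hG : MeasurableSet G) (n : ℕ)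
    {f : E → ℝ≥0∞} (hf : Measurable f) :
    ∫⁻ ω in survival step w0 X G (n + 1), f (drivenChain step w0 X (n + 1) ω) ∂P =
      ∫⁻ ω in survival step w0 X G n, ∫⁻ x in {x | (drivenChain step w0 X n ω, x) ∈ G},
        f (step (drivenChain step w0 X n ω, x)) ∂μ ∂P := by
  have hm := measurable_past hX n
  have hA := hm _ (measurableSet_survival (w0 := w0) (X := X) hstep hG n)
  have hW := (measurable_drivenChain (w0 := w0) (X := X) hstep n).mono hm le_rfl
  have key := setLIntegral_survival (w0 := w0) hX hind hlaw hstep hG n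
    (f := G.indicator fun p => f (step p)) ((hf.comp hstep).indicator hG)
  have hB : MeasurableSet {ω | (drivenChain step w0 X n ω, X n ω) ∈ G} := (hW.prodMk (hX n)) hG
  rw [survival_succ, Set.inter_comm, ← setLIntegral_indicator hB]
  refine Eq.trans ?_ (key.trans ?_)
  · rfl
  · refine lintegral_congr fun ω => ?_
    exact lintegral_indicator (measurable_prodMk_left hG : MeasurableSet (Prod.mk _ ⁻¹' G)) _

theorem measure_survival_diff (hX : ∀ n, Measurable (X n)) (hind : iIndepFun X P)
    (hlaw : ∀ n, P.map (X n) = μ) (hstep : Measurable step) (hG : MeasurableSet G) (n : ℕ) :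
    P (survival step w0 X G n \ survival step w0 X G (n + 1)) =
      ∫⁻ ω in survival step w0 X G n, μ {x | (drivenChain step w0 X n ω, x) ∉ G} ∂P := by
  have hm := measurable_past hX n
  have hA := hm _ (measurableSet_survival (w0 := w0) (X := X) hstep hG n)
  have hW := (measurable_drivenChain (w0 := w0) (X := X) hstep n).mono hm le_rfl
  have key := setLIntegral_survival (w0 := w0) hX hind hlaw hstep hG n
    (f := Gᶜ.indicator fun _ => 1) (measurable_const.indicator hG.compl)
  have hB : MeasurableSet {ω | (drivenChain step w0 X n ω, X n ω) ∈ Gᶜ} :=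
    (hW.prodMk (hX n)) hG.compl
  have e1 : survival step w0 X G n \ survival step w0 X G (n + 1) =
      {ω | (drivenChain step w0 X n ω, X n ω) ∈ Gᶜ} ∩ survival step w0 X G n := by
    rw [survival_succ]; ext ω
    simp only [Set.mem_sdiff, Set.mem_inter_iff, Set.mem_ofPred_eq, Set.mem_compl_iff]
    tauto
  rw [e1, ← setLIntegral_one, ← setLIntegral_indicator hB]
  refine Eq.trans ?_ (key.trans ?_)
  · rfl
  · refine lintegral_congr fun ω => ?_
    rw [← setLIntegral_one]
    exact lintegral_indicator (measurable_prodMk_left hG.compl : MeasurableSet (Prod.mk _ ⁻¹' Gᶜ)) _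

end Chain

/-! ### Survival of the rescaled chain. -/

/-- The rescaled iterates, as a chain driven by the samples. -/
noncomputable def ratioChain {Ω E : Type*} [NormedAddCommGroup E] [InnerProductSpace ℝ E] (e0 : E)
    (β : ℝ) (w0 : E) (X : ℕ → Ω → E) : ℕ → Ω → E :=
  drivenChain (fun p => ratioStep e0 β p.1 p.2) w0 X

/-- The event that the first `n` steps of the rescaled iteration are good. -/
def goodEvent {Ω E : Type*} [NormedAddCommGroup E] [InnerProductSpace ℝ E] (e0 : E)
    (β : ℝ) (m : ℕ) (Rmax : ℝ) (w0 : E) (X : ℕ → Ω → E) (n : ℕ) : Set Ω :=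
  survival (fun p => ratioStep e0 β p.1 p.2) w0 X (goodStep e0 β m Rmax) n

theorem one_add_ne_zero_of_goodStep {E : Type*} [NormedAddCommGroup E] [InnerProductSpace ℝ E]
    {e0 w x : E} {β Rmax : ℝ} {m : ℕ} (hm : 1 ≤ m) (h : (w, x) ∈ goodStep e0 β m Rmax) :
    1 + β * (inner ℝ e0 x * inner ℝ w x) ≠ 0 := by
  have := h.2.2.1
  have hm' : (1 : ℝ) ≤ m := by exact_mod_cast hm
  simp only at this
  have h8 : |β * (inner ℝ e0 x * inner ℝ w x)| ≤ 1 / 8 := by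
    nlinarith [abs_nonneg (β * (inner ℝ e0 x * inner ℝ w x))]
  have := (abs_le.1 h8).1
  linarith

theorem inner_ratioStep {E : Type*} [NormedAddCommGroup E] [InnerProductSpace ℝ E]
    {e0 w x : E} {β : ℝ} (hw : inner ℝ e0 w = 1)
    (h : 1 + β * (inner ℝ e0 x * inner ℝ w x) ≠ 0) : inner ℝ e0 (ratioStep e0 β w x) = 1 := by
  rw [ratioStep, inner_smul_right, inner_add_right, inner_smul_right, hw]
  rw [show 1 + β * inner ℝ w x * inner ℝ e0 x = 1 + β * (inner ℝ e0 x * inner ℝ w x) by ring]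
  exact inv_mul_cancel₀ h

section

variable {ι E Ω : Type*} [Fintype ι] [NormedAddCommGroup E] [InnerProductSpace ℝ E]
    [MeasurableSpace E] [BorelSpace E] [SecondCountableTopology E] [MeasurableSpace Ω]
    {e : OrthonormalBasis ι ℝ E} {lam : ι → ℝ} {μ : Measure E}
    {P : Measure Ω} [IsProbabilityMeasure P] {X : ℕ → Ω → E} {o : ι} {β Rmax l1 l2 : ℝ} {m : ℕ}
    {w0 : E}

theorem measurable_ratioStep (e0 : E) (β : ℝ) :
    Measurable (fun p : E × E => ratioStep e0 β p.1 p.2) := by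
  unfold ratioStep; fun_prop

theorem measurableSet_goodStep (e0 : E) (β : ℝ) (m : ℕ) (Rmax : ℝ) :
    MeasurableSet (goodStep e0 β m Rmax) := by
  have h1 : MeasurableSet {p : E × E | inner ℝ e0 p.1 = 1} :=
    measurableSet_eq_fun (by fun_prop) (by fun_prop)
  have h2 : MeasurableSet {p : E × E | ‖p.1‖ ^ 2 ≤ Rmax} :=
    measurableSet_le (by fun_prop) (by fun_prop)
  have h3 : MeasurableSet {p : E × E | 8 * m * |β * (inner ℝ e0 p.2 * inner ℝ p.1 p.2)| ≤ 1} :=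
    measurableSet_le (Measurable.const_mul (Measurable.abs (by fun_prop)) _) (by fun_prop)
  have h4 : MeasurableSet {p : E × E | 8 * m * (β * inner ℝ p.1 p.2 ^ 2) ≤ ‖p.1‖ ^ 2} :=
    measurableSet_le (by fun_prop) (by fun_prop)
  have h5 : MeasurableSet {p : E × E |
      4 * m * (β ^ 2 * (inner ℝ p.1 p.2 ^ 2 * ‖p.2‖ ^ 2)) ≤ ‖p.1‖ ^ 2} :=
    measurableSet_le (by fun_prop) (by fun_prop)
  exact h1.inter (h2.inter (h3.inter (h4.inter h5)))

theorem measurable_ratioChain (hX : ∀ n, Measurable (X n)) (e0 : E) (β : ℝ) (w0 : E) (n : ℕ) :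
    Measurable (ratioChain e0 β w0 X n) :=
  (measurable_drivenChain (measurable_ratioStep e0 β) n).mono (measurable_past hX n) le_rfl

theorem measurableSet_goodEvent (hX : ∀ n, Measurable (X n)) (e0 : E) (β : ℝ) (m : ℕ) (Rmax : ℝ)
    (w0 : E) (n : ℕ) : MeasurableSet (goodEvent e0 β m Rmax w0 X n) :=
  measurable_past hX n _
    (measurableSet_survival (measurable_ratioStep e0 β) (measurableSet_goodStep e0 β m Rmax) n)

theorem inner_ratioChain_eq_one {e0 : E} (hm : 1 ≤ m) (hw0 : inner ℝ e0 w0 = 1) {n : ℕ} {ω : Ω}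
    (hω : ω ∈ goodEvent e0 β m Rmax w0 X n) : inner ℝ e0 (ratioChain e0 β w0 X n ω) = 1 := by
  induction n with
  | zero => exact hw0
  | succ n ih =>
    exact inner_ratioStep (ih fun i hi => hω i (hi.trans n.lt_succ_self))
      (one_add_ne_zero_of_goodStep hm (hω n n.lt_succ_self))

/-- A bound for the one-step transition carries over to the chain on the good event. -/
theorem setLIntegral_goodEvent_succ_le (hX : ∀ n, Measurable (X n)) (hind : iIndepFun X P)
    (hlaw : ∀ n, P.map (X n) = μ) (hm : 1 ≤ m) {e0 : E} (hw0 : inner ℝ e0 w0 = 1) (n : ℕ)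
    {f g : E → ℝ≥0∞} (hf : Measurable f) (hg : Measurable g)
    (hfg : ∀ w, inner ℝ e0 w = 1 → ‖w‖ ^ 2 ≤ Rmax →
      ∫⁻ x in {x | (w, x) ∈ goodStep e0 β m Rmax}, f (ratioStep e0 β w x) ∂μ ≤ g w) :
    ∫⁻ ω in goodEvent e0 β m Rmax w0 X (n + 1), f (ratioChain e0 β w0 X (n + 1) ω) ∂P ≤
      ∫⁻ ω in goodEvent e0 β m Rmax w0 X n, g (ratioChain e0 β w0 X n ω) ∂P := by
  refine (setLIntegral_survival_succ hX hind hlaw (measurable_ratioStep e0 β)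
    (measurableSet_goodStep e0 β m Rmax) n hf).trans_le ?_
  refine setLIntegral_mono (hg.comp (measurable_ratioChain hX e0 β w0 n)) fun ω hω => ?_
  by_cases hR : ‖ratioChain e0 β w0 X n ω‖ ^ 2 ≤ Rmax
  · exact hfg _ (inner_ratioChain_eq_one hm hw0 hω) hR
  · have : {x | (ratioChain e0 β w0 X n ω, x) ∈ goodStep e0 β m Rmax} = ∅ := by
      ext x; simp only [Set.mem_ofPred_eq, Set.mem_empty_iff_false, iff_false]
      exact fun h => hR h.2.1
    change ∫⁻ x in {x | (ratioChain e0 β w0 X n ω, x) ∈ goodStep e0 β m Rmax}, _ ∂μ ≤ _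
    rw [this]; simp

theorem setLIntegral_norm_pow_le (h : SpectralMoments e lam μ) (hX : ∀ n, Measurable (X n))
    (hind : iIndepFun X P)
    (hlaw : ∀ n, P.map (X n) = μ) (ho : lam o = l1) (hl2 : ∀ k ≠ o, lam k ≤ l2)
    (hl : ∀ k, lam k ≤ l1) (hβ : 0 < β) (hm : 1 ≤ m)
    (h1 : β * l1 ^ 2 * (704 * m * Rmax + 48 * Fintype.card ι) ≤ l1 - l2)
    (h2 : m * (β * (l1 - l2)) ≤ 1) (hw0 : inner ℝ (e o) w0 = 1) (n : ℕ) :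
    ∫⁻ ω in goodEvent (e o) β m Rmax w0 X n,
        ENNReal.ofReal ((‖ratioChain (e o) β w0 X n ω‖ ^ 2) ^ m) ∂P ≤
      ENNReal.ofReal ((‖w0‖ ^ 2) ^ m + n * (2 * 2 ^ m)) := by
  have : Nonempty ι := ⟨o⟩
  have : IsProbabilityMeasure μ := hlaw 0 ▸ Measure.isProbabilityMeasure_map (hX 0).aemeasurable
  induction n with
  | zero =>
    refine (setLIntegral_le_lintegral _ _).trans (le_of_eq ?_)
    simp [ratioChain, drivenChain]
  | succ n ih =>
    refine (setLIntegral_goodEvent_succ_le hX hind hlaw hm hw0 n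
      (f := fun w => ENNReal.ofReal ((‖w‖ ^ 2) ^ m))
      (g := fun w => ENNReal.ofReal ((‖w‖ ^ 2) ^ m + 2 * 2 ^ m)) (by fun_prop) (by fun_prop)
      (fun w hw hR => h.lintegral_norm_pow_le ho hl2 hl hβ hm h1 h2 w hw hR)).trans ?_
    have e1 : ∀ w : E, ENNReal.ofReal ((‖w‖ ^ 2) ^ m + 2 * 2 ^ m)
        = ENNReal.ofReal ((‖w‖ ^ 2) ^ m) + ENNReal.ofReal (2 * 2 ^ m) :=
      fun w => ENNReal.ofReal_add (by positivity) (by positivity)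
    simp only [e1]
    rw [lintegral_add_right _ measurable_const]
    refine (add_le_add ih (setLIntegral_const _ _ |>.trans_le
      (mul_le_of_le_one_right' prob_le_one))).trans (le_of_eq ?_)
    rw [← ENNReal.ofReal_add (by positivity) (by positivity)]
    congr 1; push_cast; ring

/-- The first failure at step `n` comes either from a bad sample, with probability at most `3e⁻ᵐ`,
or from a norm above `Rmax`, with probability at most `(1 + 2n)e⁻ᵐ` by the accumulated moment.
Summing over the steps gives the quadratic factor. -/
theorem measure_compl_goodEvent_le (h : SpectralMoments e lam μ) (hX : ∀ n, Measurable (X n))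
    (hind : iIndepFun X P)
    (hlaw : ∀ n, P.map (X n) = μ) (ho : lam o = l1) (hl2 : ∀ k ≠ o, lam k ≤ l2)
    (hl : ∀ k, lam k ≤ l1) (hβ : 0 < β) (hm : 1 ≤ m)
    (h1 : β * l1 ^ 2 * (704 * m * Rmax + 48 * Fintype.card ι) ≤ l1 - l2)
    (h2 : m * (β * (l1 - l2)) ≤ 1) (hw0 : inner ℝ (e o) w0 = 1)
    (h3 : 4096 * (m ^ 4 * (β ^ 2 * l1 ^ 2 * Rmax)) ≤ 1) (h4 : 64 * (m ^ 2 * (β * l1)) ≤ 1)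
    (h5 : 256 * (m ^ 3 * (β ^ 2 * l1 ^ 2) * Fintype.card ι) ≤ 1)
    (hR8 : 8 ≤ Rmax) (hw0R : 4 * ‖w0‖ ^ 2 ≤ Rmax) (n : ℕ) :
    P (goodEvent (e o) β m Rmax w0 X n)ᶜ ≤
      ENNReal.ofReal (n * (4 + 2 * n) * Real.exp (-m)) := by
  have : Nonempty ι := ⟨o⟩
  have : IsProbabilityMeasure μ := hlaw 0 ▸ Measure.isProbabilityMeasure_map (hX 0).aemeasurable
  have hR0 : 0 < Rmax := by linarith
  have hq : ∀ r : ℝ, 0 ≤ r → 4 * r ≤ Rmax → r ^ m / Rmax ^ m ≤ Real.exp (-m) := by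
    intro r hr hr4
    have h3 : 1 / 4 ≤ Real.exp (-1) := by
      rw [Real.exp_neg, one_div]
      exact inv_anti₀ (Real.exp_pos _) (by linarith [Real.exp_one_lt_d9])
    rw [show Real.exp (-(m : ℝ)) = Real.exp (-1) ^ m by rw [← Real.exp_nat_mul]; ring_nf,
      ← div_pow]
    refine pow_le_pow_left₀ (by positivity) (le_trans ?_ h3) m
    rw [div_le_iff₀ hR0]; linarith
  induction n with
  | zero => simp [goodEvent, survival]
  | succ n ih =>
    have hdiff : P (goodEvent (e o) β m Rmax w0 X n \ goodEvent (e o) β m Rmax w0 X (n + 1)) ≤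
        ENNReal.ofReal ((4 + 2 * n) * Real.exp (-m)) := by
      refine (measure_survival_diff hX hind hlaw (measurable_ratioStep (e o) β)
        (measurableSet_goodStep (e o) β m Rmax) n).trans_le ?_
      have hpt : ∀ w : E, inner ℝ (e o) w = 1 → μ {x | (w, x) ∉ goodStep (e o) β m Rmax} ≤
          3 * ENNReal.ofReal (Real.exp (-m))
            + ENNReal.ofReal (Rmax ^ m)⁻¹ * ENNReal.ofReal ((‖w‖ ^ 2) ^ m) := by
        intro w hw
        by_cases hR : ‖w‖ ^ 2 ≤ Rmax
        -- Inside the ball the sample tails suffice; outside, the normalised moment is at least one,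
        -- which is Markov's inequality in pointwise form.
        · exact (h.measure_not_goodStep_le hl o hβ hm h3 h4 h5 w hw hR).trans le_self_add
        · refine prob_le_one.trans (le_trans ?_ le_add_self)
          rw [← ENNReal.ofReal_mul (by positivity), ← ENNReal.ofReal_one]
          refine ENNReal.ofReal_le_ofReal ?_
          rw [inv_mul_eq_div, one_le_div (by positivity)]
          exact pow_le_pow_left₀ hR0.le (not_le.1 hR).le m
      calc _ ≤ ∫⁻ ω in goodEvent (e o) β m Rmax w0 X n, (3 * ENNReal.ofReal (Real.exp (-m))
            + ENNReal.ofReal (Rmax ^ m)⁻¹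
              * ENNReal.ofReal ((‖ratioChain (e o) β w0 X n ω‖ ^ 2) ^ m)) ∂P := by
            have := measurable_ratioChain hX (e o) β w0 n
            exact setLIntegral_mono (by fun_prop) fun ω hω =>
              hpt _ (inner_ratioChain_eq_one hm hw0 hω)
        _ ≤ 3 * ENNReal.ofReal (Real.exp (-m)) + ENNReal.ofReal (Rmax ^ m)⁻¹
              * ENNReal.ofReal ((‖w0‖ ^ 2) ^ m + n * (2 * 2 ^ m)) := by
            rw [lintegral_add_left measurable_const, lintegral_const_mul' _ _ ENNReal.ofReal_ne_top]
            refine add_le_add (setLIntegral_const _ _ |>.trans_le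
              (mul_le_of_le_one_right' prob_le_one)) ?_
            gcongr
            exact setLIntegral_norm_pow_le h hX hind hlaw ho hl2 hl hβ hm h1 h2 hw0 n
        _ = ENNReal.ofReal (3 * Real.exp (-m)
              + (Rmax ^ m)⁻¹ * ((‖w0‖ ^ 2) ^ m + n * (2 * 2 ^ m))) := by
            rw [ENNReal.ofReal_add (p := 3 * Real.exp (-m)) (by positivity) (by positivity),
              ENNReal.ofReal_mul (p := 3) (by positivity), ENNReal.ofReal_mul (by positivity)]
            norm_num
        _ ≤ _ := by
            refine ENNReal.ofReal_le_ofReal ?_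
            have q1 := hq (‖w0‖ ^ 2) (by positivity) hw0R
            have q2 := mul_le_mul_of_nonneg_left (hq 2 (by positivity) (by linarith))
              (show (0 : ℝ) ≤ 2 * n by positivity)
            have : (Rmax ^ m)⁻¹ * ((‖w0‖ ^ 2) ^ m + n * (2 * 2 ^ m))
              = (‖w0‖ ^ 2) ^ m / Rmax ^ m + 2 * n * (2 ^ m / Rmax ^ m) := by
              rw [div_eq_mul_inv, div_eq_mul_inv]; ring
            rw [this]; linarith
    have hsub : (goodEvent (e o) β m Rmax w0 X (n + 1))ᶜ ⊆ (goodEvent (e o) β m Rmax w0 X n)ᶜ ∪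
        (goodEvent (e o) β m Rmax w0 X n \ goodEvent (e o) β m Rmax w0 X (n + 1)) := by
      intro ω hω
      by_cases hn : ω ∈ goodEvent (e o) β m Rmax w0 X n
      · exact Or.inr ⟨hn, hω⟩
      · exact Or.inl hn
    refine (measure_mono hsub).trans ((measure_union_le _ _).trans
      ((add_le_add ih hdiff).trans ?_))
    rw [← ENNReal.ofReal_add (by positivity) (by positivity)]
    refine ENNReal.ofReal_le_ofReal ?_
    have := Real.exp_pos (-(m : ℝ))
    push_cast
    have : 0 ≤ (2 * n + 2) * Real.exp (-(m : ℝ)) := by positivity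
    nlinarith

/-! ### Mean squares of the coordinates on the good event. -/

/-- The ansatz `p r + q` reproduces itself. The stationary noise `B(1 + Q) ≤ 2B` is paid by the
decay of `q`; the transient noise `B S r` is at most `1/4 b g c r`, which with `c ≤ p` is paid by
lowering the rate from `7/4` to `3/2`. -/
theorem coord_recursion_le {p q r A B S Q g D c b d : ℝ} (hr : 0 ≤ r) (hb : 0 ≤ b)
    (hA : A = 1 - 7 / 4 * (b * D)) (hgD : g ≤ D) (hcp : c ≤ p) (hg : 0 ≤ g)
    (hB0 : 0 ≤ B) (hQ : Q ≤ 1) (hS : S ≤ 2 * c * d) (hBq : 2 * B ≤ 7 / 4 * (b * D) * q)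
    (hBc : 2 * B * d ≤ 1 / 4 * (b * g)) (hc : 0 ≤ c) :
    A * (p * r + q) + B * (1 + (S * r + Q)) ≤ p * (r * (1 - 3 / 2 * (b * g))) + q := by
  have h1 : B * Q ≤ B := by nlinarith
  have h2 : B * S ≤ 1 / 4 * (b * g) * c := by
    calc B * S ≤ B * (2 * c * d) := mul_le_mul_of_nonneg_left hS hB0
      _ = (2 * B * d) * c := by ring
      _ ≤ _ := mul_le_mul_of_nonneg_right hBc hc
  have h3 : b * g ≤ b * D := mul_le_mul_of_nonneg_left hgD hb
  have h0 : 0 ≤ b * g := mul_nonneg hb hg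
  have h4 : 1 / 4 * (b * g) * c ≤ 1 / 4 * (b * g) * p := mul_le_mul_of_nonneg_left hcp (by positivity)
  have h5 : b * g * p ≤ b * D * p := mul_le_mul_of_nonneg_right h3 (hc.trans hcp)
  have h6 : 0 ≤ (7 / 4 * (b * D) * p - 3 / 2 * (b * g) * p - B * S) * r :=
    mul_nonneg (by linarith) hr
  subst hA
  nlinarith

/-- The induction runs over all coordinates at once, because the noise in each involves the whole
norm. Adding `c` to every initial square gives even a vanishing coordinate enough room for noise fed
in by the others. -/
theorem setLIntegral_coord_sq_le [DecidableEq ι] (h : SpectralMoments e lam μ)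
    (hX : ∀ n, Measurable (X n))
    (hind : iIndepFun X P)
    (hlaw : ∀ n, P.map (X n) = μ) (ho : lam o = l1) (hl2 : ∀ k ≠ o, lam k ≤ l2)
    (hl21 : l2 < l1) (hβ : 0 < β) (hm : 1 ≤ m) (hw0 : inner ℝ (e o) w0 = 1) {c : ℝ} (hc : 0 ≤ c)
    (h1 : 640 * (β * l1 ^ 2 * Rmax) ≤ l1 - l2)
    (h2 : 1664 * (β * l1 ^ 2 * Fintype.card ι) ≤ l1 - l2) (h3 : 2 * (β * l1) ≤ 1)
    (hw0c : ∑ k ∈ Finset.univ.erase o, inner ℝ (e k) w0 ^ 2 ≤ c * Fintype.card ι)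
    (n : ℕ) (k : ι) (hk : k ≠ o) :
    ∫⁻ ω in goodEvent (e o) β m Rmax w0 X n,
        ENNReal.ofReal (inner ℝ (e k) (ratioChain (e o) β w0 X n ω) ^ 2) ∂P ≤
      ENNReal.ofReal ((inner ℝ (e k) w0 ^ 2 + c) * (1 - 3 / 2 * (β * (l1 - l2))) ^ n
        + 240 * (β * (lam k * l1)) / (l1 - lam k)) := by
  have : IsProbabilityMeasure μ := hlaw 0 ▸ Measure.isProbabilityMeasure_map (hX 0).aemeasurable
  have hl : ∀ k, lam k ≤ l1 := fun k => by
    by_cases hk : k = o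
    · rw [hk, ho]
    · exact (hl2 k hk).trans hl21.le
  have hl1 : 0 ≤ l1 := ho ▸ h.lam_nonneg o
  have hl20 : 0 ≤ l2 := (h.lam_nonneg k).trans (hl2 k hk)
  set d : ℝ := ((Fintype.card ι : ℕ) : ℝ) with hd
  have hd0 : 0 < d := by
    have : Nonempty ι := ⟨o⟩
    rw [hd]; exact_mod_cast Fintype.card_pos
  have hβl2 : 0 ≤ β * l2 := by positivity
  set ρ := 1 - 3 / 2 * (β * (l1 - l2)) with hρ
  have hρ0 : 0 ≤ ρ := by rw [hρ]; nlinarith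
  have hq0 : ∀ j ≠ o, 0 ≤ 240 * (β * (lam j * l1)) / (l1 - lam j) := fun j hj =>
    div_nonneg (by have := h.lam_nonneg j; positivity) (by linarith [hl2 j hj])
  have hQ : ∑ j ∈ Finset.univ.erase o, 240 * (β * (lam j * l1)) / (l1 - lam j) ≤ 1 := by
    have : ∀ j ∈ Finset.univ.erase o, 240 * (β * (lam j * l1)) / (l1 - lam j)
        ≤ 240 * (β * l1 ^ 2) / (l1 - l2) := by
      intro j hj
      have hj' := hl2 j (Finset.ne_of_mem_erase hj)
      have := h.lam_nonneg j
      refine div_le_div₀ (by positivity) ?_ (by linarith) (by linarith)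
      rw [pow_two]; gcongr
      exact hl j
    refine (Finset.sum_le_card_nsmul _ _ _ this).trans ?_
    rw [nsmul_eq_mul]
    have hcard : ((Finset.univ.erase o).card : ℝ) ≤ d := by
      rw [hd, ← Finset.card_univ]; exact_mod_cast Finset.card_le_card (Finset.erase_subset _ _)
    refine (mul_le_mul_of_nonneg_right hcard
      (div_nonneg (by positivity) (by linarith))).trans ?_
    rw [← mul_div_assoc, div_le_one (by linarith)]
    have : 0 ≤ β * l1 ^ 2 * d := by positivity
    nlinarith
  have hS : ∑ j ∈ Finset.univ.erase o, (inner ℝ (e j) w0 ^ 2 + c) ≤ 2 * c * d := by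
    rw [Finset.sum_add_distrib, Finset.sum_const, nsmul_eq_mul]
    have hcard : ((Finset.univ.erase o).card : ℝ) ≤ d := by
      rw [hd, ← Finset.card_univ]; exact_mod_cast Finset.card_le_card (Finset.erase_subset _ _)
    have := mul_le_mul_of_nonneg_right hcard hc
    linarith
  induction n generalizing k with
  | zero =>
    refine (setLIntegral_le_lintegral _ _).trans ?_
    simp only [ratioChain, drivenChain, lintegral_const, measure_univ, mul_one, pow_zero]
    refine ENNReal.ofReal_le_ofReal ?_
    have := hq0 k hk
    linarith
  | succ n ih =>
    have hΔ : l1 - l2 ≤ l1 - lam k := by linarith [hl2 k hk]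
    have hlk := h.lam_nonneg k
    set A := 1 - 7 / 4 * (β * (l1 - lam k)) with hA
    set B := 208 * (β ^ 2 * (lam k * l1)) with hB
    have hA0 : 0 ≤ A := by rw [hA]; nlinarith [mul_nonneg hβ.le hlk]
    have hB0 : 0 ≤ B := by positivity
    have hk1 : 640 * (β ^ 2 * l1 ^ 2 * Rmax) ≤ β * (l1 - lam k) := by
      have := mul_le_mul_of_nonneg_left (h1.trans hΔ) hβ.le
      linarith
    refine (setLIntegral_goodEvent_succ_le hX hind hlaw hm hw0 n
      (f := fun w => ENNReal.ofReal (inner ℝ (e k) w ^ 2))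
      (g := fun w => ENNReal.ofReal (A * inner ℝ (e k) w ^ 2 + B * ‖w‖ ^ 2)) (by fun_prop)
      (by fun_prop) (fun w hw hR => h.lintegral_coord_sq_le hl ho hβ hm k hk1 w hw hR)).trans ?_
    have hW := measurable_ratioChain hX (e o) β w0 n
    have hexpand : ∀ ω ∈ goodEvent (e o) β m Rmax w0 X n,
        ENNReal.ofReal (A * inner ℝ (e k) (ratioChain (e o) β w0 X n ω) ^ 2
          + B * ‖ratioChain (e o) β w0 X n ω‖ ^ 2) ≤
        ENNReal.ofReal A * ENNReal.ofReal (inner ℝ (e k) (ratioChain (e o) β w0 X n ω) ^ 2)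
          + ENNReal.ofReal B * (1 + ∑ j ∈ Finset.univ.erase o,
            ENNReal.ofReal (inner ℝ (e j) (ratioChain (e o) β w0 X n ω) ^ 2)) := by
      intro ω hω
      have hin := inner_ratioChain_eq_one hm hw0 hω
      rw [SpectralMoments.norm_sq_eq_sum e, ← Finset.add_sum_erase _ _ (Finset.mem_univ o), hin,
        ← ENNReal.ofReal_sum_of_nonneg fun j _ => sq_nonneg _, ← ENNReal.ofReal_one,
        ← ENNReal.ofReal_add zero_le_one (Finset.sum_nonneg fun j _ => sq_nonneg _),
        ← ENNReal.ofReal_mul hA0, ← ENNReal.ofReal_mul hB0,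
        ← ENNReal.ofReal_add (by positivity)
          (mul_nonneg hB0 (add_nonneg zero_le_one (Finset.sum_nonneg fun j _ => sq_nonneg _))),
        one_pow]
    refine (setLIntegral_mono (by fun_prop) hexpand).trans ?_
    rw [lintegral_add_left (by fun_prop), lintegral_const_mul' _ _ ENNReal.ofReal_ne_top,
      lintegral_const_mul' _ _ ENNReal.ofReal_ne_top, lintegral_add_left measurable_const,
      lintegral_finsetSum _ (fun j _ => by fun_prop)]
    have hpos : ∀ j ≠ o, 0 ≤ (inner ℝ (e j) w0 ^ 2 + c) * ρ ^ n
        + 240 * (β * (lam j * l1)) / (l1 - lam j) := fun j hj =>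
      add_nonneg (by positivity) (hq0 j hj)
    have hsum : ∑ j ∈ Finset.univ.erase o, ∫⁻ ω in goodEvent (e o) β m Rmax w0 X n,
        ENNReal.ofReal (inner ℝ (e j) (ratioChain (e o) β w0 X n ω) ^ 2) ∂P ≤
        ENNReal.ofReal (∑ j ∈ Finset.univ.erase o, ((inner ℝ (e j) w0 ^ 2 + c) * ρ ^ n
          + 240 * (β * (lam j * l1)) / (l1 - lam j))) := by
      rw [ENNReal.ofReal_sum_of_nonneg fun j hj => hpos j (Finset.ne_of_mem_erase hj)]
      exact Finset.sum_le_sum fun j hj => ih j (Finset.ne_of_mem_erase hj)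
    have hone : ∫⁻ _ in goodEvent (e o) β m Rmax w0 X n, (1 : ℝ≥0∞) ∂P ≤ ENNReal.ofReal 1 := by
      rw [setLIntegral_one, ENNReal.ofReal_one]; exact prob_le_one
    have hs0 : 0 ≤ ∑ j ∈ Finset.univ.erase o, ((inner ℝ (e j) w0 ^ 2 + c) * ρ ^ n
          + 240 * (β * (lam j * l1)) / (l1 - lam j)) :=
      Finset.sum_nonneg fun j hj => hpos j (Finset.ne_of_mem_erase hj)
    refine (add_le_add (mul_le_mul_right (ih k hk) (ENNReal.ofReal A))
      (mul_le_mul_right (add_le_add hone hsum) (ENNReal.ofReal B))).trans ?_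
    rw [← ENNReal.ofReal_add zero_le_one hs0, ← ENNReal.ofReal_mul hA0, ← ENNReal.ofReal_mul hB0,
      ← ENNReal.ofReal_add (mul_nonneg hA0 (hpos k hk)) (mul_nonneg hB0 (by linarith))]
    refine ENNReal.ofReal_le_ofReal ?_
    rw [Finset.sum_add_distrib, ← Finset.sum_mul, pow_succ]
    have hlk1 : lam k * l1 ≤ l1 ^ 2 := by rw [pow_two]; exact mul_le_mul_of_nonneg_right (hl k) hl1
    refine coord_recursion_le (by positivity) hβ.le hA hΔ ?_ (by linarith) hB0 hQ hS ?_ ?_ hc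
    · linarith [sq_nonneg (inner ℝ (e k) w0)]
    -- The constant `240` is chosen so that `7/4 * 240 = 420` exceeds `2 * 208 = 416`.
    · have : 7 / 4 * (β * (l1 - lam k)) * (240 * (β * (lam k * l1)) / (l1 - lam k))
        = 420 * (β ^ 2 * (lam k * l1)) := by
        have : l1 - lam k ≠ 0 := by linarith
        field_simp; ring
      rw [this, hB]
      have : 0 ≤ β ^ 2 * (lam k * l1) := by positivity
      linarith
    · have e1 := mul_le_mul_of_nonneg_left h2 hβ.le
      have e2 : β ^ 2 * (lam k * l1) * d ≤ β ^ 2 * l1 ^ 2 * d := by gcongr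
      rw [hB]
      nlinarith

theorem setLIntegral_sum_coord_sq_le [DecidableEq ι] (h : SpectralMoments e lam μ)
    (hX : ∀ n, Measurable (X n))
    (hind : iIndepFun X P)
    (hlaw : ∀ n, P.map (X n) = μ) (ho : lam o = l1) (hl2 : ∀ k ≠ o, lam k ≤ l2)
    (hl21 : l2 < l1) (hβ : 0 < β) (hm : 1 ≤ m) (hw0 : inner ℝ (e o) w0 = 1) {c : ℝ} (hc : 0 ≤ c)
    (h1 : 640 * (β * l1 ^ 2 * Rmax) ≤ l1 - l2)
    (h2 : 1664 * (β * l1 ^ 2 * Fintype.card ι) ≤ l1 - l2) (h3 : 2 * (β * l1) ≤ 1)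
    (hl20 : 0 ≤ l2)
    (hw0c : ∑ k ∈ Finset.univ.erase o, inner ℝ (e k) w0 ^ 2 ≤ c * Fintype.card ι) (n : ℕ) :
    ∫⁻ ω in goodEvent (e o) β m Rmax w0 X n, ENNReal.ofReal
        (∑ k ∈ Finset.univ.erase o, inner ℝ (e k) (ratioChain (e o) β w0 X n ω) ^ 2) ∂P ≤
      ENNReal.ofReal (2 * c * Fintype.card ι * (1 - 3 / 2 * (β * (l1 - l2))) ^ n
        + ∑ k ∈ Finset.univ.erase o, 240 * (β * (lam k * l1)) / (l1 - lam k)) := by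
  have hW := measurable_ratioChain hX (e o) β w0 n
  have e1 : ∀ ω, ENNReal.ofReal (∑ k ∈ Finset.univ.erase o,
      inner ℝ (e k) (ratioChain (e o) β w0 X n ω) ^ 2) = ∑ k ∈ Finset.univ.erase o,
        ENNReal.ofReal (inner ℝ (e k) (ratioChain (e o) β w0 X n ω) ^ 2) :=
    fun ω => ENNReal.ofReal_sum_of_nonneg fun j _ => sq_nonneg _
  have hρ0 : 0 ≤ 1 - 3 / 2 * (β * (l1 - l2)) := by nlinarith [mul_nonneg hβ.le hl20]
  have hl1 : 0 ≤ l1 := ho ▸ h.lam_nonneg o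
  simp only [e1]
  rw [lintegral_finsetSum _ (fun j _ => by fun_prop)]
  refine (Finset.sum_le_sum fun k hk => setLIntegral_coord_sq_le h hX hind hlaw ho hl2 hl21 hβ hm
    hw0 hc h1 h2 h3 hw0c n k (Finset.ne_of_mem_erase hk)).trans ?_
  rw [← ENNReal.ofReal_sum_of_nonneg]
  · refine ENNReal.ofReal_le_ofReal ?_
    rw [Finset.sum_add_distrib, ← Finset.sum_mul, Finset.sum_add_distrib, Finset.sum_const,
      nsmul_eq_mul]
    have hcard : ((Finset.univ.erase o).card : ℝ) ≤ ((Fintype.card ι : ℕ) : ℝ) := by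
      rw [← Finset.card_univ]; exact_mod_cast Finset.card_le_card (Finset.erase_subset _ _)
    have := mul_le_mul_of_nonneg_right hcard hc
    gcongr
    linarith
  · intro k hk
    have hk' := hl2 k (Finset.ne_of_mem_erase hk)
    have := h.lam_nonneg k
    have : 0 ≤ 240 * (β * (lam k * l1)) / (l1 - lam k) :=
      div_nonneg (by positivity) (by linarith)
    positivity

end

/-! ### From the matrix and subgaussian assumptions to spectral moments. -/

theorem inner_matAct {d : ℕ} {A : Matrix (Fin d) (Fin d) ℝ} (hA : A.IsHermitian)
    (v w : EuclideanSpace ℝ (Fin d)) : inner ℝ v (matAct A w) = inner ℝ (matAct A v) w := by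
  simp only [matAct, PiLp.inner_apply, RCLike.inner_apply, conj_trivial]
  change (A.mulVec w.ofLp) ⬝ᵥ v.ofLp = w.ofLp ⬝ᵥ A.mulVec v.ofLp
  rw [Matrix.dotProduct_mulVec, ← Matrix.mulVec_transpose, ← Matrix.conjTranspose_eq_transpose_of_trivial,
    hA.eq, dotProduct_comm, dotProduct_comm]

theorem matAct_sqrt_matAct_sqrt {d : ℕ} {S : Matrix (Fin d) (Fin d) ℝ} (hS : S.PosSemidef)
    (v : EuclideanSpace ℝ (Fin d)) : matAct (CFC.sqrt S) (matAct (CFC.sqrt S) v) = matAct S v := by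
  simp only [matAct, Matrix.mulVec_mulVec]
  rw [CFC.sqrt_mul_sqrt_self S (Matrix.nonneg_iff_posSemidef.2 hS)]

theorem isHermitian_sqrt {d : ℕ} (S : Matrix (Fin d) (Fin d) ℝ) : (CFC.sqrt S).IsHermitian :=
  (Matrix.nonneg_iff_posSemidef.1 (CFC.sqrt_nonneg S)).isHermitian

theorem inner_matAct_eq_sum {d : ℕ} {S : Matrix (Fin d) (Fin d) ℝ} (hS : S.IsHermitian)
    {e : OrthonormalBasis (Fin d) ℝ (EuclideanSpace ℝ (Fin d))} {lam : Fin d → ℝ}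
    (he : ∀ k, matAct S (e k) = lam k • e k) (v w : EuclideanSpace ℝ (Fin d)) :
    inner ℝ v (matAct S w) = ∑ k, lam k * (inner ℝ (e k) v * inner ℝ (e k) w) := by
  rw [← e.sum_inner_mul_inner v (matAct S w)]
  refine Finset.sum_congr rfl fun k _ => ?_
  rw [inner_matAct hS, he, inner_smul_left, real_inner_comm]
  simp only [conj_trivial]; ring

theorem inner_matAct_sqrt {d : ℕ} {S : Matrix (Fin d) (Fin d) ℝ} (hS : S.PosSemidef)
    {e : OrthonormalBasis (Fin d) ℝ (EuclideanSpace ℝ (Fin d))} {lam : Fin d → ℝ}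
    (he : ∀ k, matAct S (e k) = lam k • e k) (v w : EuclideanSpace ℝ (Fin d)) :
    inner ℝ (matAct (CFC.sqrt S) v) (matAct (CFC.sqrt S) w) =
      ∑ k, lam k * (inner ℝ (e k) v * inner ℝ (e k) w) := by
  rw [← inner_matAct (isHermitian_sqrt S), matAct_sqrt_matAct_sqrt hS,
    inner_matAct_eq_sum hS.isHermitian he]

/-- The single exponent `p = 2j` of the supremum gives `E|Y|^p ≤ p^{p/2}`. -/
theorem moment_of_psi2Norm_le_one {Ω : Type*} [MeasurableSpace Ω] {P : Measure Ω}
    {Y : Ω → ℝ} (hY : Measurable Y) (h : psi2Norm Y P ≤ 1) {j : ℕ} (hj : 1 ≤ j) :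
    Integrable (fun ω => Y ω ^ (2 * j)) P ∧ ∫ ω, Y ω ^ (2 * j) ∂P ≤ (2 * j) ^ j := by
  set p : ℝ := 2 * j with hp
  have hj' : (1 : ℝ) ≤ j := by exact_mod_cast hj
  have hp1 : 1 ≤ p := by rw [hp]; linarith
  have hp0 : 0 < p := by linarith
  have h1 : ENNReal.ofReal (p ^ (-(1 / 2) : ℝ)) * eLpNorm Y (ENNReal.ofReal p) P ≤ 1 :=
    le_trans (le_iSup₂ (f := fun (p : ℝ) (_ : 1 ≤ p) =>
      ENNReal.ofReal (p ^ (-(1 / 2) : ℝ)) * eLpNorm Y (ENNReal.ofReal p) P) p hp1) h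
  have hpos : 0 < p ^ (-(1 / 2) : ℝ) := Real.rpow_pos_of_pos hp0 _
  have hne : ENNReal.ofReal (p ^ (-(1 / 2) : ℝ)) ≠ 0 := by simpa using hpos
  have h2 : eLpNorm Y (ENNReal.ofReal p) P ≤ ENNReal.ofReal (p ^ (1 / 2 : ℝ)) := by
    rw [mul_comm, ← ENNReal.le_div_iff_mul_le (Or.inl hne) (Or.inl ENNReal.ofReal_ne_top)] at h1
    refine h1.trans (le_of_eq ?_)
    rw [one_div, ← ENNReal.ofReal_inv_of_pos hpos, Real.rpow_neg hp0.le, inv_inv]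
  have hmem : MemLp Y (ENNReal.ofReal p) P :=
    ⟨hY.aestronglyMeasurable, h2.trans_lt ENNReal.ofReal_lt_top⟩
  have hpc : ENNReal.ofReal p = ((2 * j : ℕ) : ℝ≥0∞) := by
    rw [hp, ← ENNReal.ofReal_natCast]; push_cast; rfl
  have hn : ∀ ω, ‖Y ω‖ ^ (2 * j) = Y ω ^ (2 * j) := fun ω => by
    rw [Real.norm_eq_abs, pow_mul, pow_mul, sq_abs]
  have hi : Integrable (fun ω => Y ω ^ (2 * j)) P := by
    have := (hpc ▸ hmem).integrable_norm_pow (by omega : 2 * j ≠ 0)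
    simpa only [hn] using this
  refine ⟨hi, ?_⟩
  have h3 := hmem.eLpNorm_eq_integral_rpow_norm (by simpa using hp0) ENNReal.ofReal_ne_top
  rw [h3, ENNReal.ofReal_le_ofReal_iff (by positivity), ENNReal.toReal_ofReal hp0.le] at h2
  have hI : ∫ ω, ‖Y ω‖ ^ p ∂P = ∫ ω, Y ω ^ (2 * j) ∂P := by
    refine integral_congr_ae (Filter.Eventually.of_forall fun ω => ?_)
    simp only
    rw [← hn, ← Real.rpow_natCast]; push_cast; rfl
  rw [hI] at h2
  have hI0 : 0 ≤ ∫ ω, Y ω ^ (2 * j) ∂P := integral_nonneg fun ω => by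
    simp only [Pi.zero_apply]; rw [pow_mul]; positivity
  have h4 := Real.rpow_le_rpow (by positivity) h2 hp0.le
  rw [← Real.rpow_mul hI0, inv_mul_cancel₀ hp0.ne', Real.rpow_one, ← Real.rpow_mul hp0.le] at h4
  refine h4.trans (le_of_eq ?_)
  rw [← Real.rpow_natCast]
  congr 1; rw [hp]; ring

theorem IsIsotropicSubgaussian.moment {d : ℕ} {Ω : Type*} [MeasurableSpace Ω] {P : Measure Ω}
    [IsProbabilityMeasure P]
    {Z : Ω → EuclideanSpace ℝ (Fin d)} (hZ : IsIsotropicSubgaussian Z P)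
    (v : EuclideanSpace ℝ (Fin d)) (j : ℕ) :
    Integrable (fun ω => inner ℝ v (Z ω) ^ (2 * j)) P ∧
      (1 ≤ j → ∫ ω, inner ℝ v (Z ω) ^ (2 * j) ∂P ≤ (2 * j) ^ j * (‖v‖ ^ 2) ^ j) := by
  have hm := hZ.measurable
  rcases Nat.eq_zero_or_pos j with rfl | hj
  · simp
  rcases eq_or_ne v 0 with rfl | hv
  · have : j ≠ 0 := by omega
    simp [this]
  have hv0 : ‖v‖ ≠ 0 := norm_ne_zero_iff.2 hv
  obtain ⟨h1, h2⟩ := moment_of_psi2Norm_le_one (by fun_prop)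
    (hZ.subgaussian (‖v‖⁻¹ • v) (norm_smul_inv_norm hv)) hj
  have he : ∀ ω, inner ℝ v (Z ω) ^ (2 * j)
      = (‖v‖ ^ 2) ^ j * inner ℝ (‖v‖⁻¹ • v) (Z ω) ^ (2 * j) := fun ω => by
    rw [inner_smul_left, conj_trivial, mul_pow, ← mul_assoc, ← pow_mul, ← mul_pow,
      mul_inv_cancel₀ hv0, one_pow, one_mul]
  simp only [he]
  refine ⟨h1.const_mul _, fun _ => ?_⟩
  rw [integral_const_mul, mul_comm]
  exact mul_le_mul_of_nonneg_right h2 (by positivity)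

theorem IsIsotropicSubgaussian.integral_inner_mul_inner {d : ℕ} {Ω : Type*} [MeasurableSpace Ω]
    {P : Measure Ω} [IsProbabilityMeasure P]
    {Z : Ω → EuclideanSpace ℝ (Fin d)} (hZ : IsIsotropicSubgaussian Z P)
    (v w : EuclideanSpace ℝ (Fin d)) :
    ∫ ω, inner ℝ v (Z ω) * inner ℝ w (Z ω) ∂P = inner ℝ v w := by
  have hm := hZ.measurable
  have hsq : ∀ i, MemLp (fun ω => Z ω i) 2 P := fun i => by
    have := (hZ.moment (EuclideanSpace.single i 1) 1).1
    rw [memLp_two_iff_integrable_sq (by fun_prop)]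
    simpa [EuclideanSpace.inner_single_left] using this
  have hint : ∀ i j, Integrable (fun ω => Z ω i * Z ω j) P := fun i j => (hsq i).integrable_mul (hsq j)
  have he : ∀ ω, inner ℝ v (Z ω) * inner ℝ w (Z ω) = ∑ i, ∑ j, v i * w j * (Z ω i * Z ω j) := by
    intro ω
    simp only [PiLp.inner_apply, RCLike.inner_apply, conj_trivial, Finset.sum_mul_sum]
    exact Finset.sum_congr rfl fun i _ => Finset.sum_congr rfl fun j _ => by ring
  simp only [he]
  rw [integral_finsetSum _ fun i _ => integrable_finsetSum _ fun j _ => (hint i j).const_mul _]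
  simp only [PiLp.inner_apply, RCLike.inner_apply, conj_trivial]
  refine Finset.sum_congr rfl fun i _ => ?_
  rw [integral_finsetSum _ fun j _ => (hint i j).const_mul _]
  simp only [integral_const_mul, hZ.cov, Matrix.one_apply]
  simp [mul_comm]

theorem measurable_matAct {d : ℕ} (A : Matrix (Fin d) (Fin d) ℝ) : Measurable (matAct A) := by
  have : Continuous (matAct A) := by
    unfold matAct
    exact (PiLp.continuous_toLp 2 _).comp
      ((continuous_const.matrix_mulVec (PiLp.continuous_ofLp 2 _)))
  exact this.measurable

theorem spectralMoments_map_sqrt {d : ℕ} {S : Matrix (Fin d) (Fin d) ℝ} (hS : S.PosSemidef)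
    {e : OrthonormalBasis (Fin d) ℝ (EuclideanSpace ℝ (Fin d))} {lam : Fin d → ℝ}
    (he : ∀ k, matAct S (e k) = lam k • e k) {Ω : Type*} [MeasurableSpace Ω] {P : Measure Ω}
    [IsProbabilityMeasure P]
    {Z : Ω → EuclideanSpace ℝ (Fin d)} (hZ : IsIsotropicSubgaussian Z P) :
    SpectralMoments e lam (P.map fun ω => matAct (CFC.sqrt S) (Z ω)) := by
  have hsym := fun v w => inner_matAct (isHermitian_sqrt S) v w
  have hmeas : Measurable fun ω => matAct (CFC.sqrt S) (Z ω) :=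
    (measurable_matAct _).comp hZ.measurable
  have hnorm : ∀ v, ‖matAct (CFC.sqrt S) v‖ ^ 2 = ∑ k, lam k * inner ℝ (e k) v ^ 2 := fun v => by
    rw [← real_inner_self_eq_norm_sq, inner_matAct_sqrt hS he]
    simp only [pow_two]
  refine ⟨fun k => ?_, fun v w => ?_, fun v j => ?_, fun v j hj => ?_⟩
  · rw [← SpectralMoments.quad_basis e lam k, ← hnorm]; positivity
  · rw [integral_map hmeas.aemeasurable (by fun_prop)]
    simp only [hsym]
    rw [hZ.integral_inner_mul_inner, inner_matAct_sqrt hS he]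
  · rw [integrable_map_measure (by fun_prop) hmeas.aemeasurable]
    have := (hZ.moment (matAct (CFC.sqrt S) v) j).1
    simpa only [Function.comp_def, hsym] using this
  · rw [integral_map hmeas.aemeasurable (by fun_prop)]
    simp only [hsym]
    rw [← hnorm]
    exact (hZ.moment (matAct (CFC.sqrt S) v) j).2 hj

theorem exists_eigenbasis {d : ℕ} {S : Matrix (Fin d) (Fin d) ℝ} (hS : S.IsHermitian) :
    ∃ e : OrthonormalBasis (Fin d) ℝ (EuclideanSpace ℝ (Fin d)),
      ∀ k, matAct S (e k) = eigval hS k • e k := by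
  -- The eigenvectors are indexed through an arbitrary equivalence with the sorted positions; `σ`
  -- restores the decreasing order.
  set σ : Fin d ≃ Fin d := (finCongr (Fintype.card_fin d).symm).trans
    (Fintype.equivOfCardEq (Fintype.card_fin _)) with hσ
  refine ⟨hS.eigenvectorBasis.reindex σ.symm, fun k => ?_⟩
  have h1 : hS.eigenvalues (σ k) = eigval hS k := by
    simp [Matrix.IsHermitian.eigenvalues, eigval, hσ]
  rw [OrthonormalBasis.reindex_apply, Equiv.symm_symm, ← h1]
  have := hS.mulVec_eigenvectorBasis (σ k)
  ext i
  simpa [matAct] using congrFun this i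

theorem eigval_antitone {d : ℕ} {S : Matrix (Fin d) (Fin d) ℝ} (hS : S.IsHermitian) :
    Antitone (eigval hS) := fun _ _ h => hS.eigenvalues₀_antitone h

/-- By the gap a maximiser has no component off `e o`, so it is `± e o`; squaring removes the sign.
-/
theorem IsPrincipalComponent.inner_sq_eq {d : ℕ} {S : Matrix (Fin d) (Fin d) ℝ}
    (hS : S.IsHermitian) {e : OrthonormalBasis (Fin d) ℝ (EuclideanSpace ℝ (Fin d))}
    {lam : Fin d → ℝ} (he : ∀ k, matAct S (e k) = lam k • e k) {o : Fin d}
    (ho : ∀ k ≠ o, lam k < lam o) {u : EuclideanSpace ℝ (Fin d)} (hu : IsPrincipalComponent S u)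
    (v : EuclideanSpace ℝ (Fin d)) : inner ℝ v u ^ 2 = inner ℝ (e o) v ^ 2 := by
  have h1 : inner ℝ (e o) (matAct S (e o)) ≤ inner ℝ u (matAct S u) :=
    hu.2 (show e o ∈ Metric.sphere 0 1 by simp)
  rw [he, inner_smul_right, real_inner_self_eq_norm_sq, e.norm_eq_one,
    inner_matAct_eq_sum hS he] at h1
  have h2 : ∑ k, inner ℝ (e k) u ^ 2 = 1 := by
    rw [← SpectralMoments.norm_sq_eq_sum, hu.1, one_pow]
  have h3 : ∑ k, (lam o - lam k) * inner ℝ (e k) u ^ 2 ≤ 0 := by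
    have : ∑ k, (lam o - lam k) * inner ℝ (e k) u ^ 2 = lam o * ∑ k, inner ℝ (e k) u ^ 2
        - ∑ k, lam k * (inner ℝ (e k) u * inner ℝ (e k) u) := by
      rw [Finset.mul_sum, ← Finset.sum_sub_distrib]
      exact Finset.sum_congr rfl fun k _ => by ring
    rw [this, h2]; linarith
  have h4 : ∀ k ∈ Finset.univ, 0 ≤ (lam o - lam k) * inner ℝ (e k) u ^ 2 := fun k _ => by
    rcases eq_or_ne k o with rfl | hk
    · simp
    · exact mul_nonneg (by linarith [ho k hk]) (sq_nonneg _)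
  have h5 : ∀ k ≠ o, inner ℝ (e k) u = 0 := fun k hk => by
    have := (Finset.sum_eq_zero_iff_of_nonneg h4).1 (le_antisymm h3 (Finset.sum_nonneg h4)) k
      (Finset.mem_univ k)
    rcases mul_eq_zero.1 this with h | h
    · linarith [ho k hk]
    · simpa using h
  have h6 : inner ℝ (e o) u ^ 2 = 1 := by
    rw [← h2, Finset.sum_eq_single o (fun k _ hk => by rw [h5 k hk]; simp) (by simp)]
  rw [← e.sum_inner_mul_inner v u, Finset.sum_eq_single o (fun k _ hk => by rw [h5 k hk]; simp)
    (by simp), mul_pow, h6, mul_one, real_inner_comm]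

/-! ### The tangent in terms of the rescaled iterates. -/

/-- The multiple of `u` that has inner product one with `e0`. -/
noncomputable def ratioVec {E : Type*} [NormedAddCommGroup E] [InnerProductSpace ℝ E] (e0 u : E) :
    E := (inner ℝ e0 u)⁻¹ • u

theorem tanSqAngle_eq {d : ℕ} {e : OrthonormalBasis (Fin d) ℝ (EuclideanSpace ℝ (Fin d))}
    {o : Fin d} {u w : EuclideanSpace ℝ (Fin d)} (hw : ‖w‖ = 1)
    (huw : inner ℝ u w ^ 2 = inner ℝ (e o) u ^ 2) (hu : inner ℝ (e o) u ≠ 0) :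
    tanSqAngle u w =
      ENNReal.ofReal (∑ k ∈ Finset.univ.erase o, inner ℝ (e k) (ratioVec (e o) u) ^ 2) := by
  have huw0 : inner ℝ u w ≠ 0 := fun h => hu (by rw [h] at huw; simpa using huw.symm)
  have hu0 : ‖u‖ ≠ 0 := norm_ne_zero_iff.2 (by rintro rfl; simp at hu)
  rw [tanSqAngle, if_neg (fun h => huw0
    (InnerProductGeometry.inner_eq_zero_iff_angle_eq_pi_div_two u w |>.2 h))]
  congr 1
  have hc : Real.cos (InnerProductGeometry.angle u w) = inner ℝ u w / ‖u‖ := by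
    rw [InnerProductGeometry.cos_angle, hw, mul_one]
  have hc0 : Real.cos (InnerProductGeometry.angle u w) ≠ 0 := by
    rw [hc]; exact div_ne_zero huw0 hu0
  have h1 : Real.tan (InnerProductGeometry.angle u w) ^ 2 = ‖u‖ ^ 2 / inner ℝ (e o) u ^ 2 - 1 := by
    rw [Real.tan_eq_sin_div_cos, div_pow, Real.sin_sq, hc, div_pow, huw]
    field_simp
  have h2 := SpectralMoments.norm_sq_eq_sum e u
  rw [← Finset.add_sum_erase _ _ (Finset.mem_univ o)] at h2
  rw [h1, h2, add_div, div_self (by positivity), add_sub_cancel_left, Finset.sum_div]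
  refine Finset.sum_congr rfl fun k _ => ?_
  rw [ratioVec, inner_smul_right, mul_pow, inv_pow, inv_mul_eq_div]

theorem tanSqAngle_of_inner_eq_zero {d : ℕ} {u w : EuclideanSpace ℝ (Fin d)}
    (h : inner ℝ u w = 0) : tanSqAngle u w = ∞ := by
  rw [tanSqAngle, if_pos (InnerProductGeometry.inner_eq_zero_iff_angle_eq_pi_div_two u w |>.1 h)]

theorem inner_ratioVec {E : Type*} [NormedAddCommGroup E] [InnerProductSpace ℝ E] {e0 u : E}
    (h : inner ℝ e0 u ≠ 0) : inner ℝ e0 (ratioVec e0 u) = 1 := by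
  rw [ratioVec, inner_smul_right, inv_mul_cancel₀ h]

/-- The unnormalised update is linear in the iterate, so scalar factors cancel in the ratio. Good
steps keep the denominator nonzero. -/
theorem ratioVec_onlinePCA {d : ℕ} {Ω : Type*} {e0 u0 : EuclideanSpace ℝ (Fin d)} {β Rmax : ℝ}
    {m : ℕ} (hm : 1 ≤ m) {X : ℕ → Ω → EuclideanSpace ℝ (Fin d)} (hu0 : inner ℝ e0 u0 ≠ 0) {n : ℕ}
    {ω : Ω} (hω : ω ∈ goodEvent e0 β m Rmax (ratioVec e0 u0) X n) :
    inner ℝ e0 (onlinePCA β u0 X n ω) ≠ 0 ∧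
      ratioVec e0 (onlinePCA β u0 X n ω) = ratioChain e0 β (ratioVec e0 u0) X n ω := by
  induction n with
  | zero => exact ⟨hu0, rfl⟩
  | succ n ih =>
    obtain ⟨h1, h2⟩ := ih fun i hi => hω i (hi.trans n.lt_succ_self)
    have h3 := one_add_ne_zero_of_goodStep hm (hω n n.lt_succ_self)
    have hchain : ratioChain e0 β (ratioVec e0 u0) X (n + 1) ω
      = ratioStep e0 β (ratioChain e0 β (ratioVec e0 u0) X n ω) (X n ω) := rfl
    change 1 + β * (inner ℝ e0 (X n ω) *
      inner ℝ (ratioChain e0 β (ratioVec e0 u0) X n ω) (X n ω)) ≠ 0 at h3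
    rw [hchain]
    rw [← h2] at h3 ⊢
    simp only [onlinePCA, sphereProj]
    set u := onlinePCA β u0 X n ω
    set x := X n ω
    set v := u + β • (inner ℝ x u • x) with hv
    have hY : inner ℝ (ratioVec e0 u) x = (inner ℝ e0 u)⁻¹ * inner ℝ x u := by
      rw [ratioVec, inner_smul_left, conj_trivial, real_inner_comm u x]
    have h4 : inner ℝ e0 v
        = inner ℝ e0 u * (1 + β * (inner ℝ e0 x * inner ℝ (ratioVec e0 u) x)) := by
      rw [hv, inner_add_right, inner_smul_right, inner_smul_right, hY]
      field_simp
    have h5 : inner ℝ e0 v ≠ 0 := h4 ▸ mul_ne_zero h1 h3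
    have h6 : ‖v‖⁻¹ ≠ 0 := inv_ne_zero (norm_ne_zero_iff.2 (by
      intro h; rw [h] at h5; simp at h5))
    refine ⟨by rw [inner_smul_right]; exact mul_ne_zero h6 h5, ?_⟩
    have h7 : v = inner ℝ e0 u • (ratioVec e0 u + (β * inner ℝ (ratioVec e0 u) x) • x) := by
      rw [smul_add, hY, smul_smul, ratioVec, smul_smul, mul_inv_cancel₀ h1, one_smul, hv, smul_smul]
      congr 2; field_simp
    rw [ratioVec, inner_smul_right, smul_smul, mul_inv, mul_comm ‖v‖⁻¹⁻¹, mul_assoc,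
      inv_mul_cancel₀ h6, mul_one, h4, mul_inv, ratioStep]
    conv_lhs => rw [h7]
    rw [smul_smul, mul_comm (inner ℝ e0 u)⁻¹, mul_assoc, inv_mul_cancel₀ h1, mul_one]

/-! ### Times, failure probability and stepsize conditions. -/

/-- Since `(1 - 3x/2)² ≤ (1 - x)³`, the power is at most `(1 - x)^{3n/2}`, and the two times give
`(B / T)^{3/2}`. The surplus power of `T` is discarded. -/
theorem pow_le_of_rescaledTime {x B T : ℝ} (hx : 0 < x) (hx1 : x ≤ 1 / 8) (hT : 1 ≤ T)
    {n n1 n2 : ℕ} (h1 : -Real.log B / -Real.log (1 - x) ≤ n1)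
    (h2 : Real.log T / -Real.log (1 - x) ≤ n2) (hn : n1 + n2 ≤ n) :
    (1 - 3 / 2 * x) ^ n ≤ Real.exp (3 / 2 * Real.log B) / T := by
  have hL : 0 < -Real.log (1 - x) := by
    have := Real.log_neg (show 0 < 1 - x by linarith) (by linarith); linarith
  have hρ : 0 < 1 - 3 / 2 * x := by linarith
  rw [div_le_iff₀ hL] at h1 h2
  have hn' : (n1 : ℝ) + n2 ≤ n := by exact_mod_cast hn
  have hlog : 2 * Real.log (1 - 3 / 2 * x) ≤ 3 * Real.log (1 - x) := by
    have e1 := Real.log_pow (1 - 3 / 2 * x) 2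
    have e2 := Real.log_pow (1 - x) 3
    push_cast at e1 e2
    rw [← e1, ← e2]
    refine Real.log_le_log (by positivity) ?_
    nlinarith [mul_nonneg (sq_nonneg x) (show 0 ≤ 3 / 4 - x by linarith)]
  have hT0 : 0 < T := by linarith
  have hlT : 0 ≤ Real.log T := Real.log_nonneg hT
  rw [← Real.exp_log (pow_pos hρ n), Real.log_pow, ← Real.exp_log hT0, ← Real.exp_sub]
  refine Real.exp_le_exp.2 ?_
  have h3 := mul_le_mul_of_nonneg_left hlog (show (0 : ℝ) ≤ n by positivity)
  have h4 := mul_le_mul_of_nonneg_right hn' hL.le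
  nlinarith

/-- With `z = exp(-y/4)` one has `e⁻ᵐ ≤ z²`. If `N z ≥ 1` the claimed lower bound is not positive,
hence void; otherwise `6 (N z)² ≤ 6 N z ≤ 4 d N z`. The term `a` is only discarded. -/
theorem failure_bound {N y d a : ℝ} {m : ℕ} (hN : N = 0 ∨ 1 ≤ N) (hd : 2 ≤ d) (hy : y ≤ 2 * m)
    (ha : 0 ≤ a) :
    1 - N * (4 + 2 * N) * Real.exp (-m) ≥ 1 - a - 4 * d * N * Real.exp (-(1 / 4) * y) ∨
      0 ≥ 1 - a - 4 * d * N * Real.exp (-(1 / 4) * y) := by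
  set z := Real.exp (-(1 / 4) * y) with hz
  have hz0 : 0 < z := Real.exp_pos _
  have hz2 : Real.exp (-m) ≤ z ^ 2 := by
    rw [hz, ← Real.exp_nat_mul]
    refine Real.exp_le_exp.2 ?_
    push_cast; linarith
  rcases hN with rfl | hN
  · left; simpa using ha
  · rcases le_or_gt 1 (N * z) with h | h
    · right
      nlinarith [mul_nonneg (show 0 ≤ d - 2 by linarith) (show 0 ≤ N * z by positivity)]
    · left
      have h1 : N * (4 + 2 * N) * Real.exp (-m) ≤ N * (4 + 2 * N) * z ^ 2 :=
        mul_le_mul_of_nonneg_left hz2 (by nlinarith)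
      have h2 : N * (4 + 2 * N) * z ^ 2 ≤ 6 * (N * z) ^ 2 := by
        have : 0 ≤ (N ^ 2 - N) * z ^ 2 := mul_nonneg (by nlinarith) (sq_nonneg _)
        nlinarith
      have h3 : (N * z) ^ 2 ≤ N * z := by
        have : 0 ≤ N * z := by positivity
        nlinarith
      have h4 : 2 * (N * z) ≤ d * (N * z) := mul_le_mul_of_nonneg_right hd (by positivity)
      nlinarith

/-- The correction in the summand with eigenvalue `l2` equals `betaHat l1 l2 β * s` after
multiplication by `β`, so that one summand pays for the transient `r`. -/
theorem add_sum_le_of_mem {ι : Type*} {I : Finset ι} {lam : ι → ℝ} {l1 l2 β s r f : ℝ}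
    (hlt : l2 < l1) (hl10 : 0 < l1) (hβ : 0 < β) (hs : 0 < s) (hlk : ∀ k ∈ I, lam k ≤ l2) {i : ι}
    (hi : i ∈ I) (hil : lam i = l2) (hr : r ≤ betaHat l1 l2 β * s) (hf : 0 ≤ f) :
    r + ∑ k ∈ I, 240 * (β * (lam k * l1)) / (l1 - lam k) ≤
      f + 240 * (∑ k ∈ I, (l1 * lam k + l1 ^ 2 * s) / (l1 - lam k)) * β := by
  have hpos : ∀ k ∈ I, 0 ≤ l1 ^ 2 * s / (l1 - lam k) := fun k hk =>
    div_nonneg (by positivity) (by linarith [hlk k hk])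
  have f2 := Finset.single_le_sum hpos hi
  have hg : l1 - l2 ≠ 0 := by linarith
  have f3 : l1 ^ 2 * s / (l1 - lam i) * β = betaHat l1 l2 β * s := by
    rw [hil, betaHat]; field_simp
  have f4 := mul_le_mul_of_nonneg_right f2 hβ.le
  rw [f3] at f4
  have f5 : 240 * (∑ k ∈ I, (l1 * lam k + l1 ^ 2 * s) / (l1 - lam k)) * β
      = ∑ k ∈ I, 240 * (β * (lam k * l1)) / (l1 - lam k)
        + 240 * ((∑ k ∈ I, l1 ^ 2 * s / (l1 - lam k)) * β) := by
    simp only [add_div, Finset.sum_add_distrib, Finset.mul_sum, Finset.sum_mul, mul_add, add_mul]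
    congr 1
    · exact Finset.sum_congr rfl fun k _ => by ring
    · exact Finset.sum_congr rfl fun k _ => by ring
  rw [f5]
  have : 0 ≤ betaHat l1 l2 β * s := by
    rw [← f3, hil]
    have : 0 < l1 - l2 := by linarith
    positivity
  linarith

/-- The smallness conditions on the stepsize that the analysis uses, for the moment order
`m = ⌊β̂^(-2ε)⌋` and the bound `8 c d` on the squared norm of the rescaled iterates. -/
theorem stepsize_conditions {d l1 l2 β c ε B y Rmax : ℝ} {m : ℕ} (hd2 : 2 ≤ d) (hl20 : 0 ≤ l2)
    (hlt : l2 < l1) (hβ : 0 < β) (hc : 1 < c) (hε : 0 < ε) (hε8 : ε < 1 / 8)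
    (hB : B = betaHat l1 l2 β) (hy : y = B ^ (-2 * ε)) (hm : m = ⌊y⌋₊) (hRmax : Rmax = 8 * (c * d))
    (hβd : d * B ^ (1 - 2 * ε) ≤ 1 / 1000000 / c) :
    0 < B ∧ B < 1 ∧ 1 ≤ m ∧ y ≤ 2 * m ∧ 2 ≤ c * d ∧ β * (l1 - l2) ≤ 1 / 8 ∧
    β * l1 ^ 2 * (704 * m * Rmax + 48 * d) ≤ l1 - l2 ∧
    m * (β * (l1 - l2)) ≤ 1 ∧
    4096 * (m ^ 4 * (β ^ 2 * l1 ^ 2 * Rmax)) ≤ 1 ∧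
    64 * (m ^ 2 * (β * l1)) ≤ 1 ∧
    256 * (m ^ 3 * (β ^ 2 * l1 ^ 2) * d) ≤ 1 ∧
    640 * (β * l1 ^ 2 * Rmax) ≤ l1 - l2 ∧
    1664 * (β * l1 ^ 2 * d) ≤ l1 - l2 ∧
    2 * (β * l1) ≤ 1 := by
  have hl10 : 0 < l1 := by linarith
  have hg : 0 < l1 - l2 := by linarith
  have hBdef : B = l1 ^ 2 * (l1 - l2)⁻¹ * β := hB
  have hB0 : 0 < B := by rw [hBdef]; positivity
  have hBg : β * l1 ^ 2 = B * (l1 - l2) := by rw [hBdef]; field_simp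
  have hBl : β * l1 ≤ B := by
    have : β * l1 * l1 ≤ B * l1 := by
      rw [mul_assoc, ← pow_two, hBg]; exact mul_le_mul_of_nonneg_left (by linarith) hB0.le
    exact le_of_mul_le_mul_right this hl10
  have hβg : β * (l1 - l2) ≤ B :=
    (mul_le_mul_of_nonneg_left (by linarith) hβ.le).trans hBl
  have hBy : B ^ (1 - 2 * ε) = B * y := by
    rw [hy, show 1 - 2 * ε = 1 + -2 * ε by ring, Real.rpow_add hB0, Real.rpow_one]
  have hmain : c * d * (B * y) ≤ 1 / 1000000 := by
    rw [hBy, le_div_iff₀ (by linarith)] at hβd; linarith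
  have hy0 : 0 < y := hy ▸ Real.rpow_pos_of_pos hB0 _
  have hcd : 2 ≤ c * d := by nlinarith
  have hBy6 : B * y ≤ 1 / 2000000 := by
    have := mul_le_mul_of_nonneg_right hcd (mul_pos hB0 hy0).le
    linarith
  have hB1 : B < 1 := by
    by_contra h
    have := Real.one_le_rpow (not_lt.1 h) (show 0 ≤ 1 - 2 * ε by linarith)
    rw [hBy] at this; linarith
  have hy1 : 1 ≤ y := hy ▸ Real.one_le_rpow_of_pos_of_le_one_of_nonpos hB0 hB1.le (by linarith)
  -- The exponent is `1 - 6ε`, positive because `ε < 1/8`. Every higher power of `m` below is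
  -- reduced to this bound and `hmain`.
  have hBy3 : B * y ^ 3 ≤ 1 := by
    have : B * y ^ 3 = B ^ (1 + -2 * ε * 3) := by
      rw [Real.rpow_add hB0, Real.rpow_one, Real.rpow_mul hB0.le]
      norm_num [hy]
    rw [this]
    exact Real.rpow_le_one hB0.le hB1.le (by linarith)
  have hBy2 : B * y ^ 2 ≤ 1 / 1000 := by
    refine (abs_le_of_sq_le_sq' ?_ (by norm_num)).2
    calc (B * y ^ 2) ^ 2 = (B * y) * (B * y ^ 3) := by ring
      _ ≤ (1 / 2000000) * 1 := mul_le_mul hBy6 hBy3 (by positivity) (by norm_num)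
      _ ≤ _ := by norm_num
  have hm1 : 1 ≤ m := hm ▸ (Nat.one_le_floor_iff y).2 hy1
  have hm1' : (1 : ℝ) ≤ m := by exact_mod_cast hm1
  have hmy : (m : ℝ) ≤ y := hm ▸ Nat.floor_le hy0.le
  have hym : y ≤ 2 * m := by have := Nat.lt_floor_add_one y; rw [← hm] at this; linarith
  have hBB : B ≤ 1 / 2000000 := by nlinarith
  have hcdB : c * d * B ≤ 1 / 1000000 :=
    (mul_le_mul_of_nonneg_left (le_mul_of_one_le_right hB0.le hy1) (by linarith)).trans hmain
  have hdB : d * B ≤ 1 / 1000000 := by nlinarith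
  have hcdBm : c * d * (B * m) ≤ 1 / 1000000 :=
    (mul_le_mul_of_nonneg_left (mul_le_mul_of_nonneg_left hmy hB0.le) (by linarith)).trans hmain
  have hBl2 : β ^ 2 * l1 ^ 2 ≤ B ^ 2 := by
    rw [← mul_pow]; exact pow_le_pow_left₀ (by positivity) hBl 2
  have p1 : β * l1 ^ 2 * (704 * m * Rmax + 48 * d) ≤ l1 - l2 := by
    rw [hBg, hRmax]
    have : B * (704 * m * (8 * (c * d)) + 48 * d) ≤ 1 := by linarith
    have := mul_le_mul_of_nonneg_right this hg.le
    linarith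
  have p2 : m * (β * (l1 - l2)) ≤ 1 := by
    have := mul_le_mul hmy hβg (by positivity) hy0.le
    linarith
  have hRm0 : 0 ≤ Rmax := by rw [hRmax]; linarith
  have p3 : 4096 * (m ^ 4 * (β ^ 2 * l1 ^ 2 * Rmax)) ≤ 1 := by
    have e1 : m ^ 4 * (β ^ 2 * l1 ^ 2 * Rmax) ≤ y ^ 4 * (B ^ 2 * Rmax) := by gcongr
    have e2 : y ^ 4 * (B ^ 2 * Rmax) = 8 * ((c * d * (B * y)) * (B * y ^ 3)) := by
      rw [hRmax]; ring
    have e3 : (c * d * (B * y)) * (B * y ^ 3) ≤ 1 / 1000000 * 1 :=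
      mul_le_mul hmain hBy3 (by positivity) (by norm_num)
    linarith
  have p4 : 64 * (m ^ 2 * (β * l1)) ≤ 1 := by
    have e1 : m ^ 2 * (β * l1) ≤ y ^ 2 * B := by gcongr
    linarith
  have p5 : 256 * (m ^ 3 * (β ^ 2 * l1 ^ 2) * d) ≤ 1 := by
    have e1 : m ^ 3 * (β ^ 2 * l1 ^ 2) * d ≤ y ^ 3 * B ^ 2 * d := by gcongr
    have e2 : y ^ 3 * B ^ 2 * d = (d * B) * (B * y ^ 3) := by ring
    have e3 : (d * B) * (B * y ^ 3) ≤ 1 / 1000000 * 1 :=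
      mul_le_mul hdB hBy3 (by positivity) (by norm_num)
    linarith
  have p6 : 640 * (β * l1 ^ 2 * Rmax) ≤ l1 - l2 := by
    rw [hBg, hRmax]
    have : 640 * (B * (8 * (c * d))) ≤ 1 := by linarith
    have := mul_le_mul_of_nonneg_right this hg.le
    linarith
  have p7 : 1664 * (β * l1 ^ 2 * d) ≤ l1 - l2 := by
    rw [hBg]
    have : 1664 * (B * d) ≤ 1 := by linarith
    have := mul_le_mul_of_nonneg_right this hg.le
    linarith
  have p8 : 2 * (β * l1) ≤ 1 := by linarith
  exact ⟨hB0, hB1, hm1, hym, hcd, by linarith, p1, p2, p3, p4, p5, p6, p7, p8⟩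

/-! ### Assembly. -/

theorem theorem1 :
    ∃ b1 C0 C1 C2 : ℝ, 0 < b1 ∧ b1 < Real.log 2 ^ 2 / 16 ∧ 0 < C0 ∧ 0 < C1 ∧ 0 < C2 ∧
    ∀ (d : ℕ) (hd : 2 ≤ d)
      (S : Matrix (Fin d) (Fin d) ℝ) (hS : S.PosSemidef)
      (l1 l2 : ℝ) (_ : l1 = eigval hS.isHermitian ⟨0, by omega⟩)
      (_ : l2 = eigval hS.isHermitian ⟨1, by omega⟩)
      (_ : l2 < l1)
      (ustar : EuclideanSpace ℝ (Fin d)) (_ : IsPrincipalComponent S ustar)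
      {Ω' : Type*} [MeasurableSpace Ω'] (P' : Measure Ω') [IsProbabilityMeasure P']
      (Z : Ω' → EuclideanSpace ℝ (Fin d)) (_ : IsIsotropicSubgaussian Z P')
      {Ω : Type*} [MeasurableSpace Ω] (P : Measure Ω) [IsProbabilityMeasure P]
      (X : ℕ → Ω → EuclideanSpace ℝ (Fin d)) (_ : ∀ n, Measurable (X n))
      (_ : iIndepFun X P)
      (_ : ∀ n, IdentDistrib (X n) (fun ω' => matAct (CFC.sqrt S) (Z ω')) P P')
      (u0 : EuclideanSpace ℝ (Fin d)) (_ : ‖u0‖ = 1)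
      (cstar : ℝ) (_ : 1 < cstar)
      (_ : tanSqAngle u0 ustar ≤ ENNReal.ofReal (cstar * d))
      (ε : ℝ) (_ : 0 < ε) (_ : ε < 1 / 8)
      (β : ℝ) (_ : 0 < β)
      (_ : (d : ℝ) * betaHat l1 l2 β ^ (1 - 2 * ε) ≤ b1 / cstar)
      (t : ℝ) (_ : 1 < t),
      ∃ H : Set Ω, MeasurableSet H ∧
        P.real H ≥ 1
          - 2 * ((d : ℝ) + 2) * (burnInTime d l1 l2 β cstar : ℝ)
              * Real.exp (-C0 * betaHat l1 l2 β ^ (-2 * ε))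
          - 4 * (d : ℝ) * (rescaledTime l1 l2 β t : ℝ)
              * Real.exp (-C1 * betaHat l1 l2 β ^ (-2 * ε)) ∧
        ∀ n : ℕ, rescaledTime l1 l2 β 1 + burnInTime d l1 l2 β cstar ≤ n →
          n ≤ rescaledTime l1 l2 β t →
          ∫⁻ ω in H, tanSqAngle (onlinePCA β u0 X n ω) ustar ∂P ≤
            ENNReal.ofReal
              ((1 - β * (l1 - l2)) ^ (2 * (n - burnInTime d l1 l2 β cstar))
                + C2 * (∑ k ∈ Finset.univ.filter (fun k : Fin d => 1 ≤ (k : ℕ)),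
                    (l1 * eigval hS.isHermitian k
                      + l1 ^ 2 * betaHat l1 l2 β ^ (0.5 - 4 * ε))
                      / (l1 - eigval hS.isHermitian k)) * β) := by
  -- Any positive `C0` would do, as its term is dropped. `C1 = 1/4` is the rate from
  -- `failure_bound`, and `C2 = 240` the constant of the stationary level.
  refine ⟨1 / 1000000, 1, 1 / 4, 240, by norm_num, ?_, one_pos, by norm_num, by norm_num, ?_⟩
  · have := Real.log_two_gt_d9
    nlinarith
  intro d hd S hS l1 l2 hl1 hl2 hlt ustar hustar Ω' _ P' _ Z hZ Ω _ P _ X hX hind hident u0 hu0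
    c hc htan ε hε hε8 β hβ hβd t ht
  classical
  set o : Fin d := ⟨0, by omega⟩ with ho
  set lam : Fin d → ℝ := eigval hS.isHermitian with hlam
  obtain ⟨e, he⟩ := exists_eigenbasis hS.isHermitian
  set μ := P'.map fun ω' => matAct (CFC.sqrt S) (Z ω') with hμ
  have hlaw : ∀ n, P.map (X n) = μ := fun n => (hident n).map_eq
  have hsm : SpectralMoments e lam μ := spectralMoments_map_sqrt hS he hZ
  have hanti := eigval_antitone hS.isHermitian
  have hlo : lam o = l1 := hl1.symm
  have hk1 : ∀ k : Fin d, k ≠ o → 1 ≤ (k : ℕ) := fun k hk => by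
    rcases Nat.eq_zero_or_pos (k : ℕ) with h | h
    · exact absurd (Fin.ext h) hk
    · exact h
  have hlk : ∀ k ≠ o, lam k ≤ l2 := fun k hk => by
    rw [hl2]; exact hanti (Fin.mk_le_of_le_val (hk1 k hk))
  have hl20 : 0 ≤ l2 := hl2 ▸ hsm.lam_nonneg _
  have hl10 : 0 < l1 := by linarith
  have hll : ∀ k, lam k ≤ l1 := fun k => by
    rcases eq_or_ne k o with rfl | hk
    · exact hlo.le
    · exact (hlk k hk).trans hlt.le
  have hg : 0 < l1 - l2 := by linarith
  have hd2 : (2 : ℝ) ≤ d := by exact_mod_cast hd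
  have hcard : ((Fintype.card (Fin d) : ℕ) : ℝ) = d := by simp
  obtain ⟨hB0, hB1, hm1, hym, hcd, hx8, p1, p2, p3, p4, p5, p6, p7, p8⟩ :=
    stepsize_conditions hd2 hl20 hlt hβ hc hε hε8 rfl rfl rfl rfl hβd
  set B := betaHat l1 l2 β with hB
  have hBdef : B = l1 ^ 2 * (l1 - l2)⁻¹ * β := rfl
  set y := B ^ (-2 * ε) with hy
  set m := ⌊y⌋₊ with hm
  set Rmax := 8 * (c * d) with hRmax
  rw [← hcard] at p1 p5 p7
  have hin : ∀ v, inner ℝ v ustar ^ 2 = inner ℝ (e o) v ^ 2 :=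
    hustar.inner_sq_eq hS.isHermitian he fun k hk => by
      have := hlk k hk
      change lam k < lam o
      rw [hlo]; linarith
  have hu00 : inner ℝ (e o) u0 ≠ 0 := fun h => by
    have h1 := hin u0
    rw [h, zero_pow two_ne_zero, sq_eq_zero_iff] at h1
    rw [tanSqAngle_of_inner_eq_zero h1] at htan
    exact ENNReal.ofReal_ne_top (top_le_iff.1 htan)
  set w0 := ratioVec (e o) u0 with hw0
  have hw01 : inner ℝ (e o) w0 = 1 := inner_ratioVec hu00
  have hw0c : ∑ k ∈ Finset.univ.erase o, inner ℝ (e k) w0 ^ 2 ≤ c * Fintype.card (Fin d) := by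
    rw [hcard]
    rw [tanSqAngle_eq hustar.1 (hin u0) hu00] at htan
    exact (ENNReal.ofReal_le_ofReal_iff (by linarith)).1 htan
  -- The `8` in `Rmax`: `‖w0‖² ≤ 1 + c d ≤ 2 c d`, and Markov's inequality needs a further factor
  -- `4`.
  have hw0R : 4 * ‖w0‖ ^ 2 ≤ Rmax := by
    rw [hcard] at hw0c
    rw [SpectralMoments.norm_sq_eq_sum e, ← Finset.add_sum_erase _ _ (Finset.mem_univ o), hw01,
      hRmax]
    linarith
  set N := rescaledTime l1 l2 β t with hN
  refine ⟨goodEvent (e o) β m Rmax w0 X N, measurableSet_goodEvent hX _ _ _ _ _ _, ?_, ?_⟩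
  · have hc1 := measure_compl_goodEvent_le hsm hX hind hlaw hlo hlk hll hβ hm1 p1 p2 hw01 p3 p4 p5
      (by linarith) hw0R N
    have hmeas := measurableSet_goodEvent hX (e o) β m Rmax w0 N
    have hc2 : P.real (goodEvent (e o) β m Rmax w0 X N)ᶜ
        ≤ N * (4 + 2 * N) * Real.exp (-m) := by
      rw [measureReal_def]
      exact ENNReal.toReal_le_of_le_ofReal (by positivity) hc1
    rw [probReal_compl_eq_one_sub hmeas] at hc2
    have hN01 : (N : ℝ) = 0 ∨ 1 ≤ (N : ℝ) := by
      rcases Nat.eq_zero_or_pos N with h | h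
      · left; exact_mod_cast h
      · right; exact_mod_cast h
    rcases failure_bound (a := 2 * ((d : ℝ) + 2) * (burnInTime d l1 l2 β c : ℝ)
      * Real.exp (-1 * y)) hN01 hd2 hym (by positivity) with h | h
    · linarith
    · exact h.le.trans measureReal_nonneg
  intro n hn1 hnN
  have hρn : (1 - 3 / 2 * (β * (l1 - l2))) ^ n ≤ Real.exp (3 / 2 * Real.log B) / (4 * c * d) := by
    refine pow_le_of_rescaledTime (by positivity) hx8 (by linarith) ?_ (Nat.le_ceil _) hn1
    refine le_trans (le_of_eq ?_) (Nat.le_ceil _)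
    rw [one_mul, ← Real.log_inv, hBdef]
    congr 2
    field_simp
  -- The burn-in factor `4 c d` cancels the initial size `2 c d`, leaving `B^{3/2}`, which is below
  -- `B^{1.5 - 4ε}` since `B < 1`.
  have hρn' : 2 * c * Fintype.card (Fin d) * (1 - 3 / 2 * (β * (l1 - l2))) ^ n
      ≤ B * B ^ (0.5 - 4 * ε) := by
    rw [hcard]
    have e1 : Real.exp (3 / 2 * Real.log B) = B ^ (3 / 2 : ℝ) := by
      rw [Real.rpow_def_of_pos hB0, mul_comm]
    have e2 : B ^ (3 / 2 : ℝ) ≤ B * B ^ (0.5 - 4 * ε) := by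
      have : B * B ^ (0.5 - 4 * ε) = B ^ (1 + (0.5 - 4 * ε)) := by
        rw [Real.rpow_add hB0, Real.rpow_one]
      rw [this]
      exact Real.rpow_le_rpow_of_exponent_ge hB0 hB1.le (by norm_num; linarith)
    rw [e1, le_div_iff₀ (by linarith)] at hρn
    have := Real.rpow_pos_of_pos hB0 (3 / 2 : ℝ)
    linarith
  have hfilter : Finset.univ.filter (fun k : Fin d => 1 ≤ (k : ℕ)) = Finset.univ.erase o := by
    ext k
    simp only [Finset.mem_filter, Finset.mem_univ, true_and, Finset.mem_erase, and_true]
    refine ⟨fun h hk => ?_, hk1 k⟩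
    rw [hk] at h; simp [ho] at h
  -- One event serves all `n ≤ N`: good events decrease in time, so the integral is enlarged to the
  -- event at time `n`, which depends only on the first `n` samples.
  calc ∫⁻ ω in goodEvent (e o) β m Rmax w0 X N, tanSqAngle (onlinePCA β u0 X n ω) ustar ∂P
      ≤ ∫⁻ ω in goodEvent (e o) β m Rmax w0 X n, tanSqAngle (onlinePCA β u0 X n ω) ustar ∂P :=
        lintegral_mono_set (survival_antitone hnN)
    _ = ∫⁻ ω in goodEvent (e o) β m Rmax w0 X n, ENNReal.ofReal
        (∑ k ∈ Finset.univ.erase o, inner ℝ (e k) (ratioChain (e o) β w0 X n ω) ^ 2) ∂P := by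
        refine setLIntegral_congr_fun (measurableSet_goodEvent hX _ _ _ _ _ _) fun ω hω => ?_
        obtain ⟨h1, h2⟩ := ratioVec_onlinePCA hm1 hu00 hω
        rw [tanSqAngle_eq hustar.1 (hin _) h1, h2]
    _ ≤ _ := setLIntegral_sum_coord_sq_le hsm hX hind hlaw hlo hlk hlt hβ hm1 hw01
        (by linarith) p6 p7 p8 hl20 hw0c n
    _ ≤ _ := by
        refine ENNReal.ofReal_le_ofReal ?_
        rw [hfilter]
        exact add_sum_le_of_mem hlt hl10 hβ (Real.rpow_pos_of_pos hB0 _)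
          (fun k hk => hlk k (Finset.ne_of_mem_erase hk))
          (show (⟨1, by omega⟩ : Fin d) ∈ Finset.univ.erase o by simp [ho]) hl2.symm hρn'
          (pow_nonneg (by linarith) _)
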